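/- **Setting.** Let $\mathcal G=(\mathcal V,\mathcal E)$ be a finite directed graph without self-loops; $(j,i)\in\mathcal E$ means that $i$ receives from $j$; $\mathcal N_i^-$, $\mathcal N_i^+$ are the sets of in- and out-neighbors of $i$; a two-hop path $(h,p,i)$ has three distinct nodes, and $h$ is then a two-hop in-neighbor of $i$. Let $f\ge 1$. A set $\mathcal A\subseteq\mathcal V$ is $f$-local if every $i\notin\mathcal A$ has at most $f$ in-neighbors in $\mathcal A$. The nodes outside the $f$-local set $\mathcal A$ (unknown to them) are normal. At every time each node broadcasts one message, the same to all its out-neighbors. Normal nodes follow the protocol below; nodes of $\mathcal A$ broadcast anything, or nothing, with full knowledge of the network and in cooperation. A normal node uses only the messages of its in-neighbors and the topology around itself and its in-neighbors. **Protocol.** Write $\Lambda_i=(\lambda_i,\gamma_i)$ and $\Delta_{ij}=(\delta_{ij},\omega_{ij})$. Node $i$ starts from $(y_i,z_i)[0]=(x_i[0],1)$, $\Lambda_i[0]=\Delta_{ij}[0]=0$, $\mathcal A_i[0]=\emptyset$, and broadcasts $\Lambda_i[1]=(x_i[0],1)/(1+|\mathcal N_i^+|)$ at time 1 and $\Phi_i[k-1]=\big(i,\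 \mathcal A_i[k-1],\ \Lambda_i[k],\ \{(j,\Delta_{ij}[k-1])\}_{j\in\mathcal N_i^-\cup\{i\}}\big)$ at time $k\ge2$. At time $k\ge 1$, after detection has produced $\mathcal A_i[k]$, it sets $\Delta_{ij}[k]=\Lambda_j[k]$ (as received) for $j\in(\mathcal N_i^-\setminus\mathcal A_i[k])\cup\{i\}$ and $\Delta_{ij}[k]=0$ for the other in-neighbors, $\mathcal M_i^+[k]=\mathcal N_i^+\setminus\mathcal A_i[k]$, and $$(y_i,z_i)[k]=\sum_{j\in\mathcal N_i^-\cup\{i\}}(\Delta_{ij}[k]-\Delta_{ij}[k-1])+|\mathcal M_i^+[k-1]\setminus\mathcal M_i^+[k]|\,\Lambda_i[k],\qquad \Lambda_i[k+1]=\Lambda_i[k]+\frac{(y_i,z_i)[k]}{1+|\mathcal M_i^+[k]|}.$$ Its output is $r_i[k]=y_i[k]/z_i[k]$. *Detection.* $\mathcal A_i[1]$ consists of the in-neighbors $j$ that send no initial message or one with $\gamma_j[1]\ne1/(1+|\mathcal N_j^+|)$; $\mathcal A_i^2[1]=\emptyset$. At time $k\ge2$ node $i$ first adds every node $m$ that at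 least $f+1$ middle nodes of two-hop paths from $m$ to $i$ report in their sets $\mathcal A_p[k-1]$, to $\mathcal A_i$ if $m$ is a neighbor of $i$ and to $\mathcal A_i^2$ otherwise; call $S_i[k]$ the resulting union $\mathcal A_i\cup\mathcal A_i^2$ ($S_i[1]=\emptyset$). Then it adds to $\mathcal A_i$, to obtain $\mathcal A_i[k]$, every in-neighbor $j$ for which $\Phi_j[k-1]$ is missing or fails one of these checks: (1a) $\mathcal A_j[k-1]$ and $S_i[k]$ agree on $\mathcal N_j^-$; (1b) for a two-hop in-neighbor $l\notin\mathcal N_j^-$ of $j$, $l\in\mathcal A_j[k-1]$ implies $l\in S_i[k]$, and, if $l\in\mathcal N_j^+$, $l\in S_i[k-1]$ implies $l\in\mathcal A_j[k-1]$; (2) the sender ID is $j$, the listed IDs are exactly $\mathcal N_j^-\cup\{j\}$, and $\mathcal A_j[k-1]\subseteq\mathcal N_j^-\cup\mathcal N_j^+$; (3) $\Delta_{jh}[k-1]$ is $0$ if $h\in\mathcal A_j[k-1]$, and otherwise agrees with the value of $h$ in the check set of $i$, which is the value sent by $h$ itself if $h\in\mathcal N_i^-\cup\{i\}$, else a value relayed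 by at least $f+1$ middle nodes of two-hop paths from $h$ to $i$ (no check if there is none); (4) $\Lambda_j[k]$ is the value which the update above gives from the last two information sets of $j$. *Misbehavior* (defined without reference to any detection). A node $j\in\mathcal A$ misbehaves at time $1$ if it sends no initial message or a wrong $\gamma_j[1]$. It misbehaves at time $k\ge2$ if $\Phi_j[k-1]$ is missing or does not conform to the averaging algorithm with correct detection information: the IDs are as in (2); $\mathcal A_j[k-1]$ contains exactly those in-neighbors of $j$ that have misbehaved by time $k-1$, and, of the other out-neighbors, all that have misbehaved by time $k-2$ and none that has not misbehaved by time $k-1$; $\Delta_{jh}[k-1]$ is $0$ for nodes $h$ that have misbehaved by time $k-1$ and otherwise the value sent by $h$; and (4) holds. **Graph condition.** Node $h$ is *detectable* by $i$ if $h\in\mathcal N_i^-$ or there are at least $2f+1$ two-hop paths from $h$ to $i$. $\mathcal G$ satisfies the graph condition if for every $i\in\mathcal V$: 1) every two-hop in-neighbor of $i$; 2) every out-neighbor of $i$; 3) every node $l\neq i$ that is an out-neighbor of an in-neighbor of $i$, is detectable by $i$. **Theorem.** (a) The following are equivalent: (i) for every $f$-local $\mathcal A$, all initial values and every behavior of the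 nodes in $\mathcal A$, each normal node $i$ correctly detects, as soon as the information reaches it, the misbehaving nodes among its in-neighbors, out-neighbors and two-hop in-neighbors; that is, if $j\in\mathcal A$ has misbehaved by time $k$, then $j\in\mathcal A_i[k]$ if $j\in\mathcal N_i^-$, $j\in\mathcal A_i[k+1]$ if $j\in\mathcal N_i^+$, and $j\in\mathcal A_i[k+1]\cup\mathcal A_i^2[k+1]$ if $j$ is a two-hop in-neighbor of $i$; and every node in $\mathcal A_i[k]\cup\mathcal A_i^2[k]$ has misbehaved by time $k$; (ii) $\mathcal G$ satisfies the graph condition. (b) Suppose that $\mathcal G$ satisfies the graph condition and is $(f+1)$-strongly connected, i.e., removing any $f$-local set leaves a strongly connected digraph. Then for every $f$-local $\mathcal A$, all initial values and every behavior of the nodes in $\mathcal A$, every normal node $i$ satisfies $$\lim_{k\to\infty} r_i[k]=\frac1{|\mathcal N_0|}\sum_{j\in\mathcal N_0}x_j[0],$$ where $\mathcal N_0$ is the set of all nodes that never misbehave (it contains all normal nodes), and $x_j[0]$, for $j\in\mathcal N_0\cap\mathcal A$, is the value $(1+|\mathcal N_j^+|)\lambda_j[1]$ that $j$ announces. -/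

import Mathlib

open Filter Topology

namespace ResilientAverage

noncomputable section

open scoped Classical

variable {V : Type*} [Fintype V] [DecidableEq V]

/-! ### Graph notions.  `G.Adj j i` means that node `i` receives information from node `j`. -/

/-- In-neighbours of `i`. -/
def inNbrs (G : Digraph V) (i : V) : Finset V := Finset.univ.filter fun j => G.Adj j i

/-- Out-neighbours of `i`. -/
def outNbrs (G : Digraph V) (i : V) : Finset V := Finset.univ.filter fun j => G.Adj i j

/-- The middle nodes `p` of the two-hop paths `(h, p, i)`; the nodes of a path are distinct.  The
two-hop paths from `h` to `i` correspond one-to-one to these nodes. -/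
def twoHopMiddle (G : Digraph V) (h i : V) : Finset V :=
  Finset.univ.filter fun p => h ≠ i ∧ p ≠ h ∧ p ≠ i ∧ G.Adj h p ∧ G.Adj p i

/-- `h` is a two-hop in-neighbour of `i`. -/
def IsTwoHopIn (G : Digraph V) (h i : V) : Prop := (twoHopMiddle G h i).Nonempty

/-- `h` is detectable by `i`: a direct in-neighbour, or at least `2f+1` two-hop paths. -/
def Detectable (G : Digraph V) (f : ℕ) (h i : V) : Prop :=
  h ∈ inNbrs G i ∨ 2 * f + 1 ≤ (twoHopMiddle G h i).card

/-- The graph condition for the fully distributed detection algorithm. -/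
structure GraphCondition (G : Digraph V) (f : ℕ) : Prop where
  twoHop : ∀ i h, IsTwoHopIn G h i → Detectable G f h i
  out : ∀ i q, q ∈ outNbrs G i → Detectable G f q i
  outOfIn : ∀ i j l, j ∈ inNbrs G i → l ∈ outNbrs G j → l ≠ i → Detectable G f l i

/-- `A` is an `f`-local set: every node outside `A` has at most `f` in-neighbours in `A`. -/
def IsLocalSet (G : Digraph V) (f : ℕ) (A : Finset V) : Prop :=
  ∀ i, i ∉ A → (inNbrs G i ∩ A).card ≤ f

/-- The digraph left after removing the nodes of `S` is strongly connected. -/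
def StronglyConnectedWithout (G : Digraph V) (S : Finset V) : Prop :=
  ∀ u v, u ∉ S → v ∉ S → Relation.ReflTransGen (fun a b => G.Adj a b ∧ a ∉ S ∧ b ∉ S) u v

/-- `r`-strongly connected: strongly connected after removing any `(r-1)`-local set. -/
def IsRStronglyConnected (G : Digraph V) (r : ℕ) : Prop :=
  ∀ S : Finset V, IsLocalSet G (r - 1) S → StronglyConnectedWithout G S

/-! ### Messages.  A pair `(λ, γ) : ℝ × ℝ` holds a `y`- and a `z`-quantity, handled componentwise. -/

/-- The information set `Φ_i[k]`: the ID of the sender, the detected set `A_i[k]`, the sender's new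
running sums `(δ_ii[k+1|k], ω_ii[k+1|k])`, and, for every listed ID `j`, the running sums
`(δ_ij[k|k], ω_ij[k|k])`. -/
structure InfoSet (V : Type*) where
  sender : V
  detected : Finset V
  own : ℝ × ℝ
  relay : V → Option (ℝ × ℝ)

/-- Everything that is broadcast.  `init j` is the pair `(λ_j[1], γ_j[1])` sent at time `1`;
`info k j`, for `k ≥ 1`, is the information set `Φ_j[k]` sent at time `k+1` (`info 0` is never
used).  A node sends the same message to all its out-neighbours; `none` means that it does not
transmit. -/
structure Transcript (V : Type*) where
  init : V → Option (ℝ × ℝ)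
  info : ℕ → V → Option (InfoSet V)

/-- The running sums of time `k` that `j` has broadcast as its own, `(δ_jj[k|k-1], ω_jj[k|k-1])`. -/
def Transcript.ownAt (M : Transcript V) : ℕ → V → Option (ℝ × ℝ)
  | 0, _ => some 0
  | 1, j => M.init j
  | k + 2, j => (M.info (k + 1) j).map InfoSet.own

/-- The pair `(δ_jh[k|k], ω_jh[k|k])` that `j` has broadcast about `h`. -/
def Transcript.relayAt (M : Transcript V) : ℕ → V → V → Option (ℝ × ℝ)
  | 0, _, _ => some 0
  | k + 1, j, h => (M.info (k + 1) j).bind fun φ => φ.relay h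

/-- The detected set `A_j[k]` that `j` has broadcast. -/
def Transcript.reportedAt (M : Transcript V) : ℕ → V → Finset V
  | 0, _ => ∅
  | k + 1, j => ((M.info (k + 1) j).map InfoSet.detected).getD ∅

/-! ### The averaging update of the resilient average consensus algorithm -/

/-- `(λ_j[1], γ_j[1])` for a node with initial value `x`, i.e. `y_j[0] = x` and `z_j[0] = 1`. -/
def initialPair (G : Digraph V) (x : ℝ) (j : V) : ℝ × ℝ :=
  (1 + ((outNbrs G j).card : ℝ))⁻¹ • (x, 1)

/-- `(y_j[k], z_j[k])`, from the detected sets and the running sums `(δ_jh, ω_jh)` at times `k-1`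
and `k`: the increments of the running sums, plus the compensation
`|ΔM_j^+[k]| (λ_j[k], γ_j[k])`, where `ΔM_j^+[k] = M_j^+[k-1] \ M_j^+[k]`. -/
def averaging (G : Digraph V) (j : V) (detPrev det : Finset V) (tabPrev tab : V → ℝ × ℝ) : ℝ × ℝ :=
  (∑ h ∈ insert j (inNbrs G j), (tab h - tabPrev h)) +
    ((((outNbrs G j \ detPrev) \ (outNbrs G j \ det)).card : ℝ)) • tab j

/-- `(λ_j[k+1], γ_j[k+1]) = (λ_j[k], γ_j[k]) + (y_j[k], z_j[k]) / (1 + d_j^+[k])`. -/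
def nextSums (G : Digraph V) (j : V) (detPrev det : Finset V) (tabPrev tab : V → ℝ × ℝ) : ℝ × ℝ :=
  tab j + (1 + ((outNbrs G j \ det).card : ℝ))⁻¹ • averaging G j detPrev det tabPrev tab

/-! ### The fully distributed detection algorithm, as run by node `i` on what it has received -/

/-- The message of time `1` is acceptable: it is sent, and its `γ`-part belongs to `z_j[0] = 1`. -/
def AcceptableInit (G : Digraph V) (M : Transcript V) (j : V) : Prop :=
  ∃ x : ℝ, M.init j = some (initialPair G x j)

/-- The IDs in an information set of `j` are the right ones. -/
def HasCorrectIds (G : Digraph V) (j : V) (φ : InfoSet V) : Prop :=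
  φ.sender = j ∧
  (∀ h, φ.relay h ≠ none ↔ h ∈ insert j (inNbrs G j)) ∧
  φ.detected ⊆ inNbrs G j ∪ outNbrs G j

/-- The nodes `m` that `i` believes to be malicious by voting: at least `f+1` middle nodes of the
two-hop paths from `m` to `i` have `m` in their broadcast detected sets of time `k`. -/
def voted (G : Digraph V) (f : ℕ) (M : Transcript V) (i : V) (k : ℕ) : Finset V :=
  Finset.univ.filter fun m =>
    f + 1 ≤ ((twoHopMiddle G m i).filter fun p => m ∈ M.reportedAt k p).card

/-- `v` is in the check set of `i` as the pair of running sums of `h` at time `k`: either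
`h` is `i` or an in-neighbour of `i`, and `h` itself has sent `v`, or at least `f+1` middle nodes of
the two-hop paths from `h` to `i` have relayed `v`. -/
def InCheckSet (G : Digraph V) (f : ℕ) (M : Transcript V) (i : V) (k : ℕ) (h : V) (v : ℝ × ℝ) :
    Prop :=
  if h ∈ insert i (inNbrs G i) then M.ownAt k h = some v
  else f + 1 ≤ ((twoHopMiddle G h i).filter fun p => M.relayAt k p h = some v).card

/-- Node `i` finds nothing wrong with the information set `Φ_j[k+1]` of its in-neighbour `j`.
`known` is the set of malicious nodes known to `i` after the voting of the present step, just before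
the neighbours are checked, and `knownPrev` is the same set in the step before. -/
def PassesChecks (G : Digraph V) (f : ℕ) (M : Transcript V) (i : V) (knownPrev known : Finset V)
    (k : ℕ) (j : V) : Prop :=
  ∃ φ, M.info (k + 1) j = some φ ∧
    -- the IDs
    HasCorrectIds G j φ ∧
    -- detections of the in-neighbours of `j`
    (∀ h ∈ inNbrs G j, h ∈ φ.detected ↔ h ∈ known) ∧
    -- detections of the other neighbours of `j`, which `j` may learn one step later than `i`
    (∀ l, IsTwoHopIn G l j → l ∉ inNbrs G j →
      (l ∈ φ.detected → l ∈ known) ∧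
      (l ∈ outNbrs G j → l ∈ knownPrev → l ∈ φ.detected)) ∧
    -- relayed values
    (∀ h ∈ insert j (inNbrs G j),
      if h ∈ φ.detected then φ.relay h = some 0
      else ∀ v, InCheckSet G f M i (k + 1) h v → φ.relay h = some v) ∧
    -- the update, reconstructed from the last two information sets of `j`
    φ.own = nextSums G j (M.reportedAt k j) φ.detected
      (fun h => (M.relayAt k j h).getD 0) (fun h => (φ.relay h).getD 0)

/-- `det` is `A_i[k]`, `det2` is the local set `A_i^2[k]`, and `known` is what `i` knew at time `k`
after voting and before checking its in-neighbours. -/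
structure DetectionState (V : Type*) where
  det : Finset V
  det2 : Finset V
  known : Finset V

/-- The detection state of node `i` at time `k`.  All in-neighbours not yet detected are checked
against the same set `known`.  (A reporter that contradicts the outcome of the voting on one of its
own in-neighbours fails the check.) -/
def detection (G : Digraph V) (f : ℕ) (M : Transcript V) (i : V) : ℕ → DetectionState V
  | 0 => ⟨∅, ∅, ∅⟩
  | 1 => ⟨(inNbrs G i).filter fun j => ¬ AcceptableInit G M j, ∅, ∅⟩
  | k + 2 =>
    let s := detection G f M i (k + 1)
    let nbrs := inNbrs G i ∪ outNbrs G i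
    let votes := voted G f M i (k + 1)
    let det := s.det ∪ (votes ∩ nbrs)
    let det2 := s.det2 ∪ (votes \ nbrs)
    let known := det ∪ det2
    ⟨det ∪ (inNbrs G i \ det).filter fun j => ¬ PassesChecks G f M i s.known known k j,
      det2, known⟩

/-! ### The protocol of a normal node -/

/-- `(δ_ih[k], ω_ih[k])` as kept by the normal node `i`: the running sums sent by `h` (by `i`
itself for `h = i`), reset to `0` once `h` is detected. -/
def table (G : Digraph V) (f : ℕ) (M : Transcript V) (i : V) (k : ℕ) (h : V) : ℝ × ℝ :=
  if h = i ∨ h ∈ inNbrs G i \ (detection G f M i k).det then (M.ownAt k h).getD 0 else 0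

/-- `(y_i[k], z_i[k])` of the normal node `i` with initial value `x`. -/
def yz (G : Digraph V) (f : ℕ) (M : Transcript V) (x : ℝ) (i : V) : ℕ → ℝ × ℝ
  | 0 => (x, 1)
  | k + 1 => averaging G i (detection G f M i k).det (detection G f M i (k + 1)).det
      (table G f M i k) (table G f M i (k + 1))

/-- The output `r_i[k] = y_i[k] / z_i[k]`. -/
def ratio (G : Digraph V) (f : ℕ) (M : Transcript V) (x : ℝ) (i : V) (k : ℕ) : ℝ :=
  (yz G f M x i k).1 / (yz G f M x i k).2

/-- The information set `Φ_i[k+1]` of the normal node `i`. -/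
def normalInfo (G : Digraph V) (f : ℕ) (M : Transcript V) (i : V) (k : ℕ) : InfoSet V where
  sender := i
  detected := (detection G f M i (k + 1)).det
  own := nextSums G i (detection G f M i k).det (detection G f M i (k + 1)).det
    (table G f M i k) (table G f M i (k + 1))
  relay := fun h =>
    if h ∈ insert i (inNbrs G i) then some (table G f M i (k + 1) h) else none

/-- `M` is what is broadcast in a run with adversary set `A` and initial values `x`: normal nodes
follow the protocol, adversary nodes broadcast anything. -/
structure IsRun (G : Digraph V) (f : ℕ) (A : Finset V) (x : V → ℝ) (M : Transcript V) : Prop where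
  init : ∀ i, i ∉ A → M.init i = some (initialPair G (x i) i)
  info : ∀ i, i ∉ A → ∀ k, M.info (k + 1) i = some (normalInfo G f M i k)

/-! ### Misbehaviour, independent of any detection -/

/-- The information set `Φ_j[k+1]` conforms to the averaging algorithm, where `exposed` is
the set of the nodes that have misbehaved in the messages received by `j` by time `k+1`, and
`exposedPrev` is the same set for time `k`.  It has to be sent with the right IDs; `j` has to
exclude exactly the misbehaving in-neighbours, and the misbehaving other out-neighbours with a delay
of at most one step (it has no direct access to their messages); it has to relay what the other
in-neighbours have sent and to update its running sums by the algorithm. -/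
def Conforms (G : Digraph V) (M : Transcript V) (exposedPrev exposed : Finset V) (k : ℕ) (j : V) :
    Prop :=
  ∃ φ, M.info (k + 1) j = some φ ∧
    HasCorrectIds G j φ ∧
    (∀ h ∈ inNbrs G j, h ∈ φ.detected ↔ h ∈ exposed) ∧
    (∀ l ∈ outNbrs G j, l ∉ inNbrs G j →
      (l ∈ φ.detected → l ∈ exposed) ∧ (l ∈ exposedPrev → l ∈ φ.detected)) ∧
    (∀ h ∈ insert j (inNbrs G j),
      φ.relay h = if h ∈ exposed then some 0 else M.ownAt (k + 1) h) ∧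
    φ.own = nextSums G j (M.reportedAt k j) φ.detected
      (fun h => (M.relayAt k j h).getD 0) (fun h => (φ.relay h).getD 0)

/-- The adversary nodes that have misbehaved in some message sent by time `k`. -/
def misbehaved (G : Digraph V) (A : Finset V) (M : Transcript V) : ℕ → Finset V
  | 0 => ∅
  | 1 => A.filter fun j => ¬ AcceptableInit G M j
  | k + 2 => misbehaved G A M (k + 1) ∪
      A.filter fun j => ¬ Conforms G M (misbehaved G A M k) (misbehaved G A M (k + 1)) k j

/-- Each normal node detects correctly, and as soon as the messages reach it, the misbehaving nodes
among its in-neighbours, its out-neighbours and its two-hop in-neighbours: whatever the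
adversary does, an in-neighbour that has misbehaved by time `k` is in `A_i[k]`, such an out-neighbour
is in `A_i[k+1]`, such a two-hop in-neighbour is in `A_i[k+1] ∪ A_i^2[k+1]`, and
no node is taken for malicious before it has misbehaved. -/
def DetectsMisbehaviour (G : Digraph V) (f : ℕ) : Prop :=
  ∀ (A : Finset V) (x : V → ℝ) (M : Transcript V), IsLocalSet G f A → IsRun G f A x M →
    ∀ i, i ∉ A → ∀ k,
      (∀ j ∈ misbehaved G A M k,
        (j ∈ inNbrs G i → j ∈ (detection G f M i k).det) ∧
        (j ∈ outNbrs G i → j ∈ (detection G f M i (k + 1)).det) ∧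
        (IsTwoHopIn G j i →
          j ∈ (detection G f M i (k + 1)).det ∪ (detection G f M i (k + 1)).det2)) ∧
      (detection G f M i k).det ∪ (detection G f M i k).det2 ⊆ misbehaved G A M k

/-- `N_0`: the nodes that behave properly at all times; it contains all normal nodes. -/
def properNodes (G : Digraph V) (A : Finset V) (M : Transcript V) : Finset V :=
  Finset.univ.filter fun j => ∀ k, j ∉ misbehaved G A M k

/-- The initial value of `j`.  For an adversary node this is the value `y_j[0]` that it announces:
`λ_j[1] = y_j[0] / (1 + d_j^+)`. -/
def initialValue (G : Digraph V) (A : Finset V) (x : V → ℝ) (M : Transcript V) (j : V) : ℝ :=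
  if j ∈ A then (1 + ((outNbrs G j).card : ℝ)) * ((M.init j).getD 0).1 else x j

/-- Resilient average consensus: in every run, the outputs of all normal nodes converge to the
average of the initial values of the nodes that behave properly. -/
def AchievesRAC (G : Digraph V) (f : ℕ) : Prop :=
  ∀ (A : Finset V) (x : V → ℝ) (M : Transcript V), IsLocalSet G f A → IsRun G f A x M →
    ∀ i, i ∉ A →
      Tendsto (ratio G f M (x i) i) atTop
        (𝓝 ((∑ j ∈ properNodes G A M, initialValue G A x M j) / ((properNodes G A M).card : ℝ)))

end

end ResilientAverage

/-!
**Detection.**  Let `B_k` be the set of nodes that have misbehaved by time `k`.  Under the graph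
condition, `CorrectAt` (no false alarms, and every misbehaving in-neighbour is found) propagates from
times `k`, `k + 1` to time `k + 2`.  A vote of `f + 1` middle nodes contains that of a normal one, and
of `2f + 1` middle nodes at least `f + 1` are normal; hence what a normal node `i` knows after voting
agrees with `B_{k+1}` on all nodes detectable by `i`, and a value in its check set is the true one.
The nodes that occur in the checks of an in-neighbour `j` are, apart from `i` itself, `j`, its other
in-neighbours and its other out-neighbours, all detectable by the graph condition; so the local checks
decide whether `j` conforms (`passesChecks_iff_conforms`).

**Necessity.**  If at most `2f` two-hop paths lead from `h` to `i`, up to `f` middle nodes can relay a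
wrong value of `h` such that no value at all gets the `f + 1` relays needed for a check.  An
out-neighbour `q` of `i` that `i` hears neither directly nor over two hops can be silent without being
noticed.  If `i` does not hear `l` in either way, and a normal in-neighbour `j` of `i` rightly reports that `l` is silent, then
`i` takes `j` for malicious.  In all cases the adversary set has at most `f` elements, and is therefore
`f`-local.  Runs with prescribed adversary messages exist because the messages of each time depend on
earlier ones only (`exists_isRun`).

**Consensus.**  All nodes that never misbehave conform to the update, and the compensation term makes
`(1 + |M_j^+[k]|) Λ_j[k+1] = (x_j[0], 1) + ∑_h Δ_jh[k]` an invariant (`smul_ownSum_succ`), whatever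
happens while nodes are being excluded.  Once the set `B` of misbehaving nodes is complete, the pairs
`(y_j, z_j)` of the nodes outside `B` therefore have total `∑_j (x_j[0], 1)` and evolve by a
column-stochastic matrix with positive diagonal.  Every normal node is reachable from all nodes outside
`B` (`GraphCondition.reaches`), so some power of the matrix has a positive row there; vectors of total
mass zero are contracted in the `ℓ¹` norm, and the quotients converge to the quotient of the totals
(`IsColumnStochasticOn.tendsto_ratio`).
-/

namespace ResilientAverage

open scoped Classical

/-! ### Auxiliary facts -/

@[simp] theorem mem_inNbrs {V : Type*} [Fintype V] {G : Digraph V} {i j : V} :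
    j ∈ inNbrs G i ↔ G.Adj j i := by simp [inNbrs]

@[simp] theorem mem_outNbrs {V : Type*} [Fintype V] {G : Digraph V} {i j : V} :
    j ∈ outNbrs G i ↔ G.Adj i j := by simp [outNbrs]

theorem ownAt_congr {V : Type*} {M M' : Transcript V} (h0 : M.init = M'.init) {k : ℕ}
    (h : ∀ n < k, M.info n = M'.info n) : M.ownAt k = M'.ownAt k := by
  funext j
  match k with
  | 0 => rfl
  | 1 => simp [Transcript.ownAt, h0]
  | k + 2 => simp [Transcript.ownAt, h (k + 1) (by omega)]

theorem relayAt_congr {V : Type*} {M M' : Transcript V} {k : ℕ} (h : M.info k = M'.info k) :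
    M.relayAt k = M'.relayAt k := by
  funext j l
  cases k <;> simp [Transcript.relayAt, h]

theorem reportedAt_congr {V : Type*} {M M' : Transcript V} {k : ℕ} (h : M.info k = M'.info k) :
    M.reportedAt k = M'.reportedAt k := by
  funext j
  cases k <;> simp [Transcript.reportedAt, h]

theorem initialPair_ne_zero {V : Type*} [Fintype V] (G : Digraph V) (y : ℝ) (j : V) :
    initialPair G y j ≠ 0 := by
  intro h
  have h2 := congrArg Prod.snd h
  simp only [initialPair, Prod.smul_mk, smul_eq_mul, mul_one, Prod.snd_zero, inv_eq_zero] at h2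
  exact absurd h2 (by positivity)

theorem exists_covering_subset {V : Type*} [DecidableEq V] {f : ℕ} {S : Finset V}
    (hS : S.Nonempty) (hf : 1 ≤ f) (hc : S.card ≤ 2 * f) :
    ∃ F ⊆ S, F.Nonempty ∧ F.card ≤ f ∧ (S \ F).card ≤ f := by
  have hpos := hS.card_pos
  obtain ⟨F, hF, hcard⟩ := Finset.exists_subset_card_eq (Nat.min_le_right f S.card)
  refine ⟨F, hF, Finset.card_pos.1 (by omega), by omega, ?_⟩
  rw [Finset.card_sdiff_of_subset hF]
  omega

theorem one_add_card_ne_zero {V : Type*} (S : Finset V) : 1 + (S.card : ℝ) ≠ 0 := by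
  positivity

variable {V : Type*} [Fintype V] [DecidableEq V]

/-! ### Correctness of the detection under the graph condition -/

section Detection

variable {G : Digraph V} {f : ℕ} {A : Finset V} {x : V → ℝ} {M : Transcript V}

@[simp] theorem mem_twoHopMiddle {h p i : V} :
    p ∈ twoHopMiddle G h i ↔ h ≠ i ∧ p ≠ h ∧ p ≠ i ∧ G.Adj h p ∧ G.Adj p i := by
  simp [twoHopMiddle]

theorem misbehaved_subset (k : ℕ) : misbehaved G A M k ⊆ A := by
  induction k using Nat.strong_induction_on with
  | _ k ih =>
    match k with
    | 0 => simp [misbehaved]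
    | 1 => simp [misbehaved]
    | k + 2 => exact Finset.union_subset (ih (k + 1) (by omega)) (Finset.filter_subset _ _)

theorem misbehaved_subset_succ (k : ℕ) : misbehaved G A M k ⊆ misbehaved G A M (k + 1) := by
  match k with
  | 0 => simp [misbehaved]
  | k + 1 => exact Finset.subset_union_left

theorem misbehaved_mono : Monotone (misbehaved G A M) :=
  monotone_nat_of_le_succ misbehaved_subset_succ

theorem IsRun.reportedAt_eq (hM : IsRun G f A x M) {p : V} (hp : p ∉ A) (k : ℕ) :
    M.reportedAt k p = (detection G f M p k).det := by
  cases k with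
  | zero => rfl
  | succ k => simp [Transcript.reportedAt, hM.info p hp k, normalInfo]

theorem IsRun.relayAt_eq (hM : IsRun G f A x M) {p h : V} (hp : p ∉ A)
    (hh : h ∈ insert p (inNbrs G p)) (k : ℕ) :
    M.relayAt k p h = some (table G f M p k h) := by
  cases k with
  | zero => simp [Transcript.relayAt, table, Transcript.ownAt]
  | succ k =>
    simp only [Transcript.relayAt, hM.info p hp k, normalInfo, Option.bind_some]
    rw [if_pos hh]

/-- A node that has not misbehaved by time `k` has sent its running sums of time `k`. -/
theorem IsRun.ownAt_eq_some (hM : IsRun G f A x M) {k : ℕ} {j : V}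
    (hj : j ∉ misbehaved G A M k) : M.ownAt k j = some ((M.ownAt k j).getD 0) := by
  match k with
  | 0 => simp [Transcript.ownAt]
  | 1 =>
    by_cases hA : j ∈ A
    · have : AcceptableInit G M j := by simpa [misbehaved, hA] using hj
      obtain ⟨y, hy⟩ := this
      simp [Transcript.ownAt, hy]
    · simp [Transcript.ownAt, hM.init j hA]
  | k + 2 =>
    by_cases hA : j ∈ A
    · have : Conforms G M (misbehaved G A M k) (misbehaved G A M (k + 1)) k j := by
        by_contra hc
        exact hj (Finset.mem_union_right _ (by simp [hA, hc]))
      obtain ⟨φ, hφ, -⟩ := this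
      simp [Transcript.ownAt, hφ]
    · simp [Transcript.ownAt, hM.info j hA k]

/-- Among `2f+1` in-neighbours of a normal node, at least `f+1` are normal. -/
theorem IsLocalSet.succ_le_card_sdiff (hA : IsLocalSet G f A) {i : V} (hi : i ∉ A)
    {S : Finset V} (hS : S ⊆ inNbrs G i) (hc : 2 * f + 1 ≤ S.card) : f + 1 ≤ (S \ A).card := by
  have h1 : (S ∩ A).card ≤ f :=
    (Finset.card_le_card (Finset.inter_subset_inter_right hS)).trans (hA i hi)
  have h2 := Finset.card_sdiff_add_card_inter S A
  omega

/-- Among `f+1` in-neighbours of a normal node, at least one is normal. -/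
theorem IsLocalSet.exists_notMem (hA : IsLocalSet G f A) {i : V} (hi : i ∉ A)
    {S : Finset V} (hS : S ⊆ inNbrs G i) (hc : f + 1 ≤ S.card) : ∃ p ∈ S, p ∉ A := by
  by_contra! h
  have h1 : S ⊆ inNbrs G i ∩ A := fun p hp => Finset.mem_inter.2 ⟨hS hp, h p hp⟩
  have := (Finset.card_le_card h1).trans (hA i hi)
  omega

theorem twoHopMiddle_subset_inNbrs (h i : V) : twoHopMiddle G h i ⊆ inNbrs G i := fun p hp => by
  simp only [mem_twoHopMiddle] at hp
  simpa using hp.2.2.2.2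

theorem detection_det_subset (i : V) (k : ℕ) :
    (detection G f M i k).det ⊆ inNbrs G i ∪ outNbrs G i := by
  induction k using Nat.strong_induction_on with
  | _ k ih =>
    match k with
    | 0 => simp [detection]
    | 1 => exact (Finset.filter_subset _ _).trans Finset.subset_union_left
    | k + 2 =>
      refine Finset.union_subset (Finset.union_subset (ih (k + 1) (by omega))
        Finset.inter_subset_right) ?_
      exact ((Finset.filter_subset _ _).trans Finset.sdiff_subset).trans Finset.subset_union_left

theorem detection_det_subset_succ (i : V) (k : ℕ) :
    (detection G f M i k).det ⊆ (detection G f M i (k + 1)).det := by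
  match k with
  | 0 => simp [detection]
  | k + 1 => exact Finset.subset_union_left.trans Finset.subset_union_left

/-- The detections of all normal nodes are correct at time `k`: complete on in-neighbours, and
without false alarms. -/
def CorrectAt (G : Digraph V) (f : ℕ) (A : Finset V) (M : Transcript V) (k : ℕ) : Prop :=
  ∀ i, i ∉ A →
    (detection G f M i k).det ∪ (detection G f M i k).det2 ⊆ misbehaved G A M k ∧
    ∀ j ∈ inNbrs G i, j ∈ misbehaved G A M k → j ∈ (detection G f M i k).det

theorem CorrectAt.mem_det_iff {k : ℕ} (hk : CorrectAt G f A M k) {i j : V} (hi : i ∉ A)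
    (hj : j ∈ inNbrs G i) : j ∈ (detection G f M i k).det ↔ j ∈ misbehaved G A M k :=
  ⟨fun h => (hk i hi).1 (Finset.mem_union_left _ h), (hk i hi).2 j hj⟩

theorem CorrectAt.voted_subset {k : ℕ} (hk : CorrectAt G f A M k) (hA : IsLocalSet G f A)
    (hM : IsRun G f A x M) {i : V} (hi : i ∉ A) :
    voted G f M i k ⊆ misbehaved G A M k := by
  intro m hm
  simp only [voted, Finset.mem_filter, Finset.mem_univ, true_and] at hm
  obtain ⟨p, hp, hpA⟩ := hA.exists_notMem hi
    ((Finset.filter_subset _ _).trans (twoHopMiddle_subset_inNbrs m i)) hm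
  rw [Finset.mem_filter, hM.reportedAt_eq hpA] at hp
  exact (hk p hpA).1 (Finset.mem_union_left _ hp.2)

theorem CorrectAt.mem_voted {k : ℕ} (hk : CorrectAt G f A M k) (hA : IsLocalSet G f A)
    (hM : IsRun G f A x M) {i m : V} (hi : i ∉ A) (hm : m ∈ misbehaved G A M k)
    (hc : 2 * f + 1 ≤ (twoHopMiddle G m i).card) : m ∈ voted G f M i k := by
  simp only [voted, Finset.mem_filter, Finset.mem_univ, true_and]
  refine (hA.succ_le_card_sdiff hi (twoHopMiddle_subset_inNbrs m i) hc).trans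
    (Finset.card_le_card fun p hp => ?_)
  rw [Finset.mem_sdiff] at hp
  rw [Finset.mem_filter, hM.reportedAt_eq hp.2]
  have := mem_twoHopMiddle.1 hp.1
  exact ⟨hp.1, (hk p hp.2).2 m (by simpa using this.2.2.2.1) hm⟩

theorem CorrectAt.known_subset {k : ℕ} (hk : CorrectAt G f A M k) (hA : IsLocalSet G f A)
    (hM : IsRun G f A x M) {i : V} (hi : i ∉ A) :
    (detection G f M i (k + 1)).known ⊆ misbehaved G A M k := by
  cases k with
  | zero => simp [detection]
  | succ k =>
    have h1 := (hk i hi).1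
    have h2 := hk.voted_subset hA hM hi
    intro m hm
    simp only [detection, Finset.mem_union, Finset.mem_inter, Finset.mem_sdiff] at hm
    rcases hm with (hm | hm) | hm | hm
    · exact h1 (Finset.mem_union_left _ hm)
    · exact h2 hm.1
    · exact h1 (Finset.mem_union_right _ hm)
    · exact h2 hm.1

theorem CorrectAt.mem_known {k : ℕ} (hk : CorrectAt G f A M k) (hA : IsLocalSet G f A)
    (hM : IsRun G f A x M) {i m : V} (hi : i ∉ A) (hd : Detectable G f m i)
    (hm : m ∈ misbehaved G A M k) : m ∈ (detection G f M i (k + 1)).known := by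
  cases k with
  | zero => simp [misbehaved] at hm
  | succ k =>
    simp only [detection, Finset.mem_union, Finset.mem_inter, Finset.mem_sdiff]
    rcases hd with hd | hd
    · exact Or.inl (Or.inl ((hk i hi).2 m hd hm))
    · have := hk.mem_voted hA hM hi hm hd
      tauto

theorem known_subset_det_union (i : V) (k : ℕ) :
    (detection G f M i k).known ⊆ (detection G f M i k).det ∪ (detection G f M i k).det2 := by
  match k with
  | 0 => simp [detection]
  | 1 => simp [detection]
  | k + 2 => exact Finset.union_subset_union Finset.subset_union_left subset_rfl

theorem CorrectAt.mem_det_succ {k : ℕ} (hk : CorrectAt G f A M k) (hA : IsLocalSet G f A)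
    (hM : IsRun G f A x M) {i m : V} (hi : i ∉ A) (hd : Detectable G f m i)
    (hn : m ∈ outNbrs G i) (hm : m ∈ misbehaved G A M k) :
    m ∈ (detection G f M i (k + 1)).det := by
  cases k with
  | zero => simp [misbehaved] at hm
  | succ k =>
    simp only [detection, Finset.mem_union, Finset.mem_inter]
    rcases hd with hd | hd
    · exact Or.inl (Or.inl ((hk i hi).2 m hd hm))
    · exact Or.inl (Or.inr ⟨hk.mem_voted hA hM hi hm hd, Or.inr hn⟩)

theorem averaging_congr {j : V} {D D' : Finset V} {t t' u u' : V → ℝ × ℝ}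
    (ht : ∀ h ∈ insert j (inNbrs G j), t h = t' h) (hu : ∀ h ∈ insert j (inNbrs G j), u h = u' h) :
    averaging G j D D' t u = averaging G j D D' t' u' := by
  unfold averaging
  rw [hu j (Finset.mem_insert_self _ _),
    Finset.sum_congr rfl fun h hh => by rw [ht h hh, hu h hh]]

theorem nextSums_congr {j : V} {D D' : Finset V} {t t' u u' : V → ℝ × ℝ}
    (ht : ∀ h ∈ insert j (inNbrs G j), t h = t' h) (hu : ∀ h ∈ insert j (inNbrs G j), u h = u' h) :
    nextSums G j D D' t u = nextSums G j D D' t' u' := by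
  unfold nextSums
  rw [averaging_congr ht hu, hu j (Finset.mem_insert_self _ _)]

/-- A normal node keeps what the other nodes have sent, except that the exposed ones are reset. -/
theorem CorrectAt.table_eq {k : ℕ} (hk : CorrectAt G f A M k) {j h : V} (hj : j ∉ A)
    (hh : h ∈ insert j (inNbrs G j)) :
    table G f M j k h = if h ∈ misbehaved G A M k then 0 else (M.ownAt k h).getD 0 := by
  have hjB : j ∉ misbehaved G A M k := fun h' => hj (misbehaved_subset k h')
  rcases eq_or_ne h j with rfl | hne
  · simp [table, hjB]
  · have hin : h ∈ inNbrs G j := Finset.mem_of_mem_insert_of_ne hh hne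
    have hiff := hk.mem_det_iff hj hin
    unfold table
    by_cases hB : h ∈ misbehaved G A M k
    · rw [if_neg, if_pos hB]
      simp [hne, hiff, hB]
    · rw [if_pos, if_neg hB]
      right; rw [Finset.mem_sdiff, hiff]; exact ⟨hin, hB⟩

/-- A normal node whose detections are correct conforms to the averaging algorithm. -/
theorem IsRun.conforms_of_notMem (hM : IsRun G f A x M) (hgc : GraphCondition G f)
    (hA : IsLocalSet G f A) {k : ℕ} (hk : CorrectAt G f A M k)
    (hk1 : CorrectAt G f A M (k + 1)) {j : V} (hj : j ∉ A) :
    Conforms G M (misbehaved G A M k) (misbehaved G A M (k + 1)) k j := by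
  refine ⟨_, hM.info j hj k, ⟨rfl, fun h => ?_, detection_det_subset j _⟩, fun h hh => ?_,
    fun l hl hl' => ⟨fun h => ?_, fun h => ?_⟩, fun h hh => ?_, ?_⟩
  · simp [normalInfo]; tauto
  · exact hk1.mem_det_iff hj hh
  · exact (hk1 j hj).1 (Finset.mem_union_left _ h)
  · exact hk.mem_det_succ hA hM hj (hgc.out j l hl) hl h
  · simp only [normalInfo]
    rw [if_pos hh, hk1.table_eq hj hh]
    split_ifs with hB
    · rfl
    · exact (hM.ownAt_eq_some hB).symm
  · simp only [normalInfo]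
    rw [hM.reportedAt_eq hj]
    refine nextSums_congr (fun h hh => ?_) (fun h hh => ?_)
    · simp [hM.relayAt_eq hj hh]
    · rw [if_pos hh]; rfl

/-- A value in the check set of a normal node is the one sent by its owner. -/
theorem CorrectAt.inCheckSet_iff {k : ℕ} (hk : CorrectAt G f A M k) (hA : IsLocalSet G f A)
    (hM : IsRun G f A x M) {i h : V} (hi : i ∉ A) (hd : h = i ∨ Detectable G f h i)
    (hB : h ∉ misbehaved G A M k) (v : ℝ × ℝ) :
    InCheckSet G f M i k h v ↔ M.ownAt k h = some v := by
  unfold InCheckSet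
  split_ifs with hin
  · rfl
  have hc : 2 * f + 1 ≤ (twoHopMiddle G h i).card := by
    rcases hd with rfl | hd | hd
    · simp at hin
    · exact absurd (Finset.mem_insert_of_mem hd) hin
    · exact hd
  have key : ∀ p ∈ twoHopMiddle G h i, p ∉ A → M.relayAt k p h = M.ownAt k h := by
    intro p hp hpA
    have hin : h ∈ insert p (inNbrs G p) :=
      Finset.mem_insert_of_mem (by simpa using (mem_twoHopMiddle.1 hp).2.2.2.1)
    rw [hM.relayAt_eq hpA hin, hk.table_eq hpA hin, if_neg hB]
    exact (hM.ownAt_eq_some hB).symm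
  constructor
  · intro hv
    obtain ⟨p, hp, hpA⟩ := hA.exists_notMem hi
      ((Finset.filter_subset _ _).trans (twoHopMiddle_subset_inNbrs h i)) hv
    rw [Finset.mem_filter] at hp
    rw [← key p hp.1 hpA, hp.2]
  · intro hv
    refine (hA.succ_le_card_sdiff hi (twoHopMiddle_subset_inNbrs h i) hc).trans
      (Finset.card_le_card fun p hp => ?_)
    rw [Finset.mem_sdiff] at hp
    rw [Finset.mem_filter, key p hp.1 hp.2]
    exact ⟨hp.1, hv⟩

/-- The core of the correctness proof: on an in-neighbour that has not been exposed yet, the checks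
of a normal node, which use only local information, decide conformity. -/
theorem passesChecks_iff_conforms (hG : ∀ v, ¬ G.Adj v v) (hgc : GraphCondition G f)
    (hA : IsLocalSet G f A) (hM : IsRun G f A x M) {k : ℕ} (hk : CorrectAt G f A M k)
    (hk1 : CorrectAt G f A M (k + 1)) {i j : V} (hi : i ∉ A) (hj : j ∈ inNbrs G i)
    (hjB : j ∉ misbehaved G A M (k + 1)) :
    PassesChecks G f M i (detection G f M i (k + 1)).known (detection G f M i (k + 2)).known k j ↔
      Conforms G M (misbehaved G A M k) (misbehaved G A M (k + 1)) k j := by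
  have hji : G.Adj j i := by simpa using hj
  have hij : j ≠ i := fun h => hG i (h ▸ hji)
  have hknown : ∀ m, m = i ∨ Detectable G f m i →
      (m ∈ (detection G f M i (k + 2)).known ↔ m ∈ misbehaved G A M (k + 1)) := by
    rintro m (rfl | hm)
    · exact ⟨fun h => hk1.known_subset hA hM hi h, fun h => absurd (misbehaved_subset _ h) hi⟩
    · exact ⟨fun h => hk1.known_subset hA hM hi h, hk1.mem_known hA hM hi hm⟩
  have hknownPrev : ∀ m, m = i ∨ Detectable G f m i →
      (m ∈ (detection G f M i (k + 1)).known ↔ m ∈ misbehaved G A M k) := by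
    rintro m (rfl | hm)
    · exact ⟨fun h => hk.known_subset hA hM hi h, fun h => absurd (misbehaved_subset _ h) hi⟩
    · exact ⟨fun h => hk.known_subset hA hM hi h, hk.mem_known hA hM hi hm⟩
  have hdin : ∀ h ∈ inNbrs G j, h = i ∨ Detectable G f h i := by
    intro h hh
    refine or_iff_not_imp_left.2 fun hne => hgc.twoHop i h ⟨j, ?_⟩
    have hhj : G.Adj h j := by simpa using hh
    exact mem_twoHopMiddle.2 ⟨hne, fun h' => hG h (h' ▸ hhj), hij, hhj, hji⟩
  have hdout : ∀ l ∈ outNbrs G j, l = i ∨ Detectable G f l i := fun l hl =>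
    or_iff_not_imp_left.2 fun hne => hgc.outOfIn i j l hj hl hne
  have hself : j = i ∨ Detectable G f j i := Or.inr (Or.inl hj)
  unfold PassesChecks Conforms
  refine exists_congr fun φ => and_congr_right fun _ => and_congr_right fun hid => ?_
  have hjφ : j ∉ φ.detected := fun h => by
    have := hid.2.2 h
    simp [hG] at this
  have h1 : (∀ h ∈ inNbrs G j, h ∈ φ.detected ↔ h ∈ (detection G f M i (k + 2)).known) ↔
      ∀ h ∈ inNbrs G j, h ∈ φ.detected ↔ h ∈ misbehaved G A M (k + 1) :=
    forall₂_congr fun h hh => by rw [hknown h (hdin h hh)]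
  rw [h1]
  refine and_congr_right fun hdet => and_congr ?_ (and_congr ?_ Iff.rfl)
  · constructor
    · intro H l hl hlin
      have h2 : IsTwoHopIn G l j := by
        rcases hgc.out j l hl with h | h
        · exact absurd h hlin
        · exact Finset.card_pos.1 (by omega)
      obtain ⟨H1, H2⟩ := H l h2 hlin
      exact ⟨fun h => (hknown l (hdout l hl)).1 (H1 h),
        fun h => H2 hl ((hknownPrev l (hdout l hl)).2 h)⟩
    · intro H l _ hlin
      refine ⟨fun h => ?_, fun hl h => (H l hl hlin).2 ((hknownPrev l (hdout l hl)).1 h)⟩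
      have hl : l ∈ outNbrs G j := (Finset.mem_union.1 (hid.2.2 h)).resolve_left hlin
      exact (hknown l (hdout l hl)).2 ((H l hl hlin).1 h)
  · refine forall₂_congr fun h hh => ?_
    have hdh : h = i ∨ Detectable G f h i := by
      rcases Finset.mem_insert.1 hh with rfl | hh
      · exact hself
      · exact hdin h hh
    have hφB : h ∈ φ.detected ↔ h ∈ misbehaved G A M (k + 1) := by
      rcases Finset.mem_insert.1 hh with rfl | hh
      · simp [hjφ, hjB]
      · exact hdet h hh
    by_cases hB : h ∈ misbehaved G A M (k + 1)
    · rw [if_pos (hφB.2 hB), if_pos hB]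
    · rw [if_neg (fun h' => hB (hφB.1 h')), if_neg hB]
      simp only [hk1.inCheckSet_iff hA hM hi hdh hB]
      rw [hM.ownAt_eq_some hB]
      simp

theorem correctAt_one (hM : IsRun G f A x M) : CorrectAt G f A M 1 := by
  intro i hi
  have : ∀ j, ¬ AcceptableInit G M j → j ∈ A := fun j hj => by
    by_contra hA
    exact hj ⟨x j, hM.init j hA⟩
  constructor
  · intro j hj
    simp only [detection, Finset.union_empty, Finset.mem_filter] at hj
    simp only [misbehaved, Finset.mem_filter]
    exact ⟨this j hj.2, hj.2⟩
  · intro j hj hB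
    simp only [misbehaved, Finset.mem_filter] at hB
    simp only [detection, Finset.mem_filter]
    exact ⟨hj, hB.2⟩

theorem CorrectAt.succ_succ (hG : ∀ v, ¬ G.Adj v v) (hgc : GraphCondition G f)
    (hA : IsLocalSet G f A) (hM : IsRun G f A x M) {k : ℕ} (hk : CorrectAt G f A M k)
    (hk1 : CorrectAt G f A M (k + 1)) : CorrectAt G f A M (k + 2) := by
  intro i hi
  have hmono := misbehaved_subset_succ (G := G) (A := A) (M := M) (k + 1)
  have hkn := hk1.known_subset hA hM hi
  constructor
  · intro j hj
    by_cases hjB : j ∈ misbehaved G A M (k + 1)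
    · exact hmono hjB
    have hjkn : j ∉ (detection G f M i (k + 2)).known := fun h => hjB (hkn h)
    have h1 : j ∈ inNbrs G i ∧ ¬ PassesChecks G f M i (detection G f M i (k + 1)).known
        (detection G f M i (k + 2)).known k j := by
      simp only [detection, Finset.mem_union, Finset.mem_filter, Finset.mem_sdiff] at hj hjkn ⊢
      tauto
    have h2 := h1.2
    rw [passesChecks_iff_conforms hG hgc hA hM hk hk1 hi h1.1 hjB] at h2
    have hjA : j ∈ A := by
      by_contra hjA
      exact h2 (hM.conforms_of_notMem hgc hA hk hk1 hjA)
    exact Finset.mem_union_right _ (Finset.mem_filter.2 ⟨hjA, h2⟩)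
  · intro j hj hB
    by_cases hjB : j ∈ misbehaved G A M (k + 1)
    · exact detection_det_subset_succ i (k + 1) ((hk1 i hi).2 j hj hjB)
    have h2 : ¬ Conforms G M (misbehaved G A M k) (misbehaved G A M (k + 1)) k j := by
      simp only [misbehaved, Finset.mem_union, Finset.mem_filter] at hB hjB
      tauto
    rw [← passesChecks_iff_conforms hG hgc hA hM hk hk1 hi hj hjB] at h2
    simp only [detection, Finset.mem_union, Finset.mem_filter, Finset.mem_sdiff] at h2 ⊢
    tauto

theorem correctAt (hG : ∀ v, ¬ G.Adj v v) (hgc : GraphCondition G f)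
    (hA : IsLocalSet G f A) (hM : IsRun G f A x M) (k : ℕ) : CorrectAt G f A M k := by
  have h : CorrectAt G f A M k ∧ CorrectAt G f A M (k + 1) := by
    induction k with
    | zero => exact ⟨fun i _ => by simp [detection, misbehaved], correctAt_one hM⟩
    | succ k ih => exact ⟨ih.2, ih.1.succ_succ hG hgc hA hM ih.2⟩
  exact h.1

theorem detectsMisbehaviour_of_graphCondition (hG : ∀ v, ¬ G.Adj v v)
    (hgc : GraphCondition G f) : DetectsMisbehaviour G f := by
  intro A x M hA hM i hi k
  have hk := correctAt hG hgc hA hM k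
  refine ⟨fun j hj => ⟨fun h => (hk i hi).2 j h hj, fun h => ?_, fun h => ?_⟩, (hk i hi).1⟩
  · exact hk.mem_det_succ hA hM hi (hgc.out i j h) h hj
  · exact known_subset_det_union i (k + 1) (hk.mem_known hA hM hi (hgc.twoHop i j h) hj)

end Detection

/-! ### Existence of runs -/

section Runs

variable {G : Digraph V} {f : ℕ}

/-- The detections of time `k` depend only on the messages sent by time `k`. -/
theorem detection_congr {M M' : Transcript V} (h0 : M.init = M'.init) (i : V) {k : ℕ}
    (h : ∀ n < k, M.info n = M'.info n) : detection G f M i k = detection G f M' i k := by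
  induction k using Nat.strong_induction_on with
  | _ k ih =>
    match k with
    | 0 => rfl
    | 1 => simp [detection, AcceptableInit, h0]
    | k + 2 =>
      have ih := ih (k + 1) (by omega) fun n hn => h n (by omega)
      have e1 := relayAt_congr (h k (by omega))
      have e2 := relayAt_congr (h (k + 1) (by omega))
      have e3 := reportedAt_congr (h k (by omega))
      have e4 := reportedAt_congr (h (k + 1) (by omega))
      have e5 := ownAt_congr h0 (k := k + 1) fun n hn => h n (by omega)
      have hv : voted G f M i (k + 1) = voted G f M' i (k + 1) := by
        ext m
        simp [voted, e4]
      have hc : ∀ (S a b : Finset V), (S.filter fun j => ¬ PassesChecks G f M i a b k j) =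
          S.filter fun j => ¬ PassesChecks G f M' i a b k j := by
        intro S a b
        refine Finset.filter_congr fun j _ => ?_
        simp only [PassesChecks, InCheckSet, e1, e2, e3, e5, h (k + 1) (by omega)]
      simp only [detection, ih, hv, hc]

theorem table_congr {M M' : Transcript V} (h0 : M.init = M'.init) (i : V) {k : ℕ}
    (h : ∀ n < k, M.info n = M'.info n) : table G f M i k = table G f M' i k := by
  funext j
  simp only [table, detection_congr h0 i h, ownAt_congr h0 h]

theorem normalInfo_congr {M M' : Transcript V} (h0 : M.init = M'.init) (i : V) {k : ℕ}
    (h : ∀ n < k + 1, M.info n = M'.info n) : normalInfo G f M i k = normalInfo G f M' i k := by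
  have h' : ∀ n < k, M.info n = M'.info n := fun n hn => h n (by omega)
  simp only [normalInfo, detection_congr h0 i h, detection_congr h0 i h', table_congr h0 i h,
    table_congr h0 i h']

/-- The messages of a run up to the information sets `Φ[n]`, the nodes of `A` following the script
`adv`. -/
noncomputable def runPrefix (G : Digraph V) (f : ℕ) (A : Finset V)
    (start : V → Option (ℝ × ℝ)) (adv : ℕ → V → Option (InfoSet V)) : ℕ → Transcript V
  | 0 => ⟨start, fun _ _ => none⟩
  | n + 1 => ⟨start, fun k j =>
      if k = n + 1 then
        if j ∈ A then adv n j else some (normalInfo G f (runPrefix G f A start adv n) j n)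
      else (runPrefix G f A start adv n).info k j⟩

/-- Every script of the adversary nodes extends to a run. -/
theorem exists_isRun (G : Digraph V) (f : ℕ) (A : Finset V) (x : V → ℝ)
    (advInit : V → Option (ℝ × ℝ)) (adv : ℕ → V → Option (InfoSet V)) :
    ∃ M : Transcript V, IsRun G f A x M ∧ (∀ j ∈ A, M.init j = advInit j) ∧
      ∀ j ∈ A, ∀ k, M.info (k + 1) j = adv k j := by
  set start : V → Option (ℝ × ℝ) := fun j =>
    if j ∈ A then advInit j else some (initialPair G (x j) j) with hstart
  set T := runPrefix G f A start adv with hT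
  have hinit : ∀ n, (T n).init = start := fun n => by cases n <;> rfl
  have hstable : ∀ k n, k ≤ n → (T n).info k = (T k).info k := by
    intro k n hkn
    induction n, hkn using Nat.le_induction with
    | base => rfl
    | succ n hkn ih =>
      rw [← ih]
      funext j
      simp [hT, runPrefix, show k ≠ n + 1 by omega]
  refine ⟨⟨start, fun k => (T k).info k⟩, ⟨fun i hi => by simp [hstart, hi], fun i hi k => ?_⟩,
    fun j hj => by simp [hstart, hj], fun j hj k => by simp [hT, runPrefix, hj]⟩
  have : (T (k + 1)).info (k + 1) i = some (normalInfo G f (T k) i k) := by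
    simp [hT, runPrefix, hi]
  refine this.trans (congrArg some (normalInfo_congr (hinit k) i fun n hn => ?_))
  exact hstable n k (by omega)

end Runs

/-! ### Necessity of the graph condition -/

section Necessity

variable {G : Digraph V} {f : ℕ} {A : Finset V} {x : V → ℝ} {M : Transcript V}

theorem isLocalSet_of_card_le (h : A.card ≤ f) : IsLocalSet G f A := fun _ _ =>
  (Finset.card_le_card Finset.inter_subset_right).trans h

theorem mem_det_of_not_passesChecks {i j : V} {k : ℕ} (hj : j ∈ inNbrs G i)
    (h : ¬ PassesChecks G f M i (detection G f M i (k + 1)).known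
      (detection G f M i (k + 2)).known k j) : j ∈ (detection G f M i (k + 2)).det := by
  simp only [detection, Finset.mem_union, Finset.mem_filter, Finset.mem_sdiff] at h ⊢
  tauto

/-- A node without two-hop paths to `i` that is not an in-neighbour of `i` remains unknown to
`i`. -/
theorem notMem_detection_of_not_isTwoHopIn {i l : V} (h1 : l ∉ inNbrs G i)
    (h2 : ¬ IsTwoHopIn G l i) (k : ℕ) :
    l ∉ (detection G f M i k).det ∪ (detection G f M i k).det2 := by
  have hv : ∀ k, l ∉ voted G f M i k := by
    intro k
    simp [voted, Finset.not_nonempty_iff_eq_empty.1 h2]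
  induction k using Nat.strong_induction_on with
  | _ k ih =>
    match k with
    | 0 => simp [detection]
    | 1 => simp [detection, by simpa using h1]
    | k + 2 =>
      have := ih (k + 1) (by omega)
      have := hv (k + 1)
      simp only [detection, Finset.mem_union, Finset.mem_inter, Finset.mem_sdiff,
        Finset.mem_filter] at *
      tauto

/-- If at most `2f` two-hop paths lead from `h` to `i`, then up to `f` of the middle nodes can relay
a wrong value of `h` to `i`: neither this value nor the true one, relayed by the at most `f` other
middle nodes, enters the check set of `i`. -/
theorem DetectsMisbehaviour.detectable_of_isTwoHopIn (hD : DetectsMisbehaviour G f)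
    (hf : 1 ≤ f) {i h : V} (hh : IsTwoHopIn G h i) : Detectable G f h i := by
  by_contra hnd
  simp only [Detectable, not_or, not_le] at hnd
  obtain ⟨hin, hcard⟩ := hnd
  obtain ⟨F, hFsub, ⟨j, hjF⟩, hFc, hFc'⟩ := exists_covering_subset hh hf (by omega)
  have hFmid : ∀ p ∈ F, h ≠ i ∧ p ≠ h ∧ p ≠ i ∧ G.Adj h p ∧ G.Adj p i := fun p hp =>
    mem_twoHopMiddle.1 (hFsub hp)
  have hiF : i ∉ F := fun hi => (hFmid i hi).2.2.1 rfl
  have hhi : h ≠ i := (hFmid j hjF).1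
  have hhF : h ∉ F := fun hi => (hFmid h hi).2.1 rfl
  -- All initial values are `0`, so a true initial pair, with `γ`-part positive, is not the relayed `0`.
  set lie : V → V → Option (ℝ × ℝ) := fun p l =>
    if l ∈ insert p (inNbrs G p) then some (if l = h then 0 else initialPair G 0 l) else none
    with hlie
  obtain ⟨M, hM, hMinit, hMinfo⟩ := exists_isRun G f F (fun _ => 0)
    (fun p => some (initialPair G 0 p)) (fun _ p => some
      { sender := p
        detected := ∅
        own := nextSums G p ∅ ∅ (fun _ => 0) fun l => (lie p l).getD 0
        relay := lie p })
  have hinit : ∀ p, M.init p = some (initialPair G 0 p) := fun p => by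
    by_cases hp : p ∈ F
    · exact hMinit p hp
    · exact hM.init p hp
  have hacc : ∀ p, AcceptableInit G M p := fun p => ⟨0, hinit p⟩
  have hB1 : misbehaved G F M 1 = ∅ := by simp [misbehaved, hacc]
  have hdet1 : ∀ p, (detection G f M p 1).det = ∅ := fun p => by simp [detection, hacc]
  have hrep : ∀ p, M.reportedAt 1 p = ∅ := fun p => by
    by_cases hp : p ∈ F
    · simp [Transcript.reportedAt, hMinfo p hp 0]
    · rw [hM.reportedAt_eq hp, hdet1]
  have hrelF : ∀ p ∈ F, ∀ l, M.relayAt 1 p l = lie p l := fun p hp l => by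
    simp [Transcript.relayAt, hMinfo p hp 0]
  have hrelN : ∀ p, p ∉ F → ∀ l, G.Adj l p → M.relayAt 1 p l = some (initialPair G 0 l) := by
    intro p hp l hl
    rw [hM.relayAt_eq hp (by simp [hl])]
    simp [table, hdet1, hl, Transcript.ownAt, hinit]
  -- No value of `h` is in the check set of `i`; about the other nodes nobody lies.
  have hcheck : ∀ l v, InCheckSet G f M i 1 l v → l ≠ h ∧ v = initialPair G 0 l := by
    intro l v hv
    unfold InCheckSet at hv
    split_ifs at hv with hl
    · refine ⟨fun h' => ?_, ?_⟩
      · rw [h', Finset.mem_insert] at hl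
        exact hl.elim hhi hin
      · simpa [Transcript.ownAt, hinit, eq_comm] using hv
    · rcases eq_or_ne l h with rfl | hne
      · exfalso
        rcases eq_or_ne v 0 with rfl | hv0
        · have : ((twoHopMiddle G l i).filter fun p => M.relayAt 1 p l = some 0) ⊆ F := by
            intro p hp
            rw [Finset.mem_filter] at hp
            by_contra hpF
            rw [hrelN p hpF l (mem_twoHopMiddle.1 hp.1).2.2.2.1] at hp
            exact initialPair_ne_zero _ _ _ (Option.some_injective _ hp.2)
          have := Finset.card_le_card this
          omega
        · have : ((twoHopMiddle G l i).filter fun p => M.relayAt 1 p l = some v) ⊆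
              twoHopMiddle G l i \ F := by
            intro p hp
            rw [Finset.mem_filter] at hp
            refine Finset.mem_sdiff.2 ⟨hp.1, fun hpF => hv0 ?_⟩
            have hadj := (mem_twoHopMiddle.1 hp.1).2.2.2.1
            have h2 := hp.2
            rw [hrelF p hpF, hlie] at h2
            simpa [hadj, eq_comm] using h2
          have := Finset.card_le_card this
          omega
      · refine ⟨hne, ?_⟩
        obtain ⟨p, hp⟩ := Finset.card_pos.1 (Nat.lt_of_lt_of_le (Nat.succ_pos f) hv)
        rw [Finset.mem_filter] at hp
        have hadj := (mem_twoHopMiddle.1 hp.1).2.2.2.1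
        have h2 := hp.2
        by_cases hpF : p ∈ F
        · rw [hrelF p hpF, hlie] at h2
          simpa [hadj, hne, eq_comm] using h2
        · rw [hrelN p hpF l hadj] at h2
          exact (Option.some_injective _ h2).symm
  -- The liar `j` has misbehaved by time `2`, but it passes all the checks of `i`.
  have hmis : j ∈ misbehaved G F M 2 := by
    refine Finset.mem_union_right _ (Finset.mem_filter.2 ⟨hjF, ?_⟩)
    rintro ⟨φ, hφ, -, -, -, hrel, -⟩
    have hadj := (hFmid j hjF).2.2.2.1
    have h2 := hrel h (by simp [hadj])
    rw [hMinfo j hjF 0, Option.some.injEq] at hφ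
    subst hφ
    have hB1' : misbehaved G F M (0 + 1) = ∅ := hB1
    simp only [hB1', Finset.notMem_empty, if_false, zero_add, Transcript.ownAt, hinit, hlie] at h2
    simp only [Finset.mem_insert, mem_inNbrs, hadj, or_true, if_true, Option.some.injEq] at h2
    exact initialPair_ne_zero _ _ _ h2.symm
  have hpass : PassesChecks G f M i (detection G f M i 1).known ∅ 0 j := by
    refine ⟨_, hMinfo j hjF 0, ⟨rfl, fun l => ?_, by simp⟩, by simp, fun l _ _ => ?_, ?_, ?_⟩
    · simp only [hlie]
      split_ifs with hl <;> simp [hl]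
    · simp [detection]
    · intro l hl
      simp only [Finset.notMem_empty, if_false]
      intro v hv
      obtain ⟨hne, rfl⟩ := hcheck l v hv
      simp only [hlie]
      rw [if_pos hl, if_neg hne]
    · rfl
  have hjin : j ∈ inNbrs G i := by simpa using (hFmid j hjF).2.2.2.2
  have hvot : voted G f M i 1 = ∅ := by simp [voted, hrep]
  have hdet : j ∉ (detection G f M i 2).det := by
    simp only [detection] at hpass
    simp [detection, hvot, hacc, hpass]
  exact hdet (((hD F _ M (isLocalSet_of_card_le hFc) hM i hiF 2).1 j hmis).1 hjin)

/-- A node with an initial message missing is not noticed by an in-neighbour out of its reach. -/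
theorem DetectsMisbehaviour.detectable_of_mem_outNbrs (hG : ∀ v, ¬ G.Adj v v)
    (hD : DetectsMisbehaviour G f) (hf : 1 ≤ f) {i q : V} (hq : q ∈ outNbrs G i) :
    Detectable G f q i := by
  by_contra hnd
  have h2 : ¬ IsTwoHopIn G q i := fun h => hnd (hD.detectable_of_isTwoHopIn hf h)
  have h1 : q ∉ inNbrs G i := fun h => hnd (Or.inl h)
  have hiq : i ≠ q := by
    rintro rfl
    exact hG i (by simpa using hq)
  obtain ⟨M, hM, hinit, -⟩ := exists_isRun G f {q} (fun _ => 0) (fun _ => none) fun _ _ => none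
  have hmis : q ∈ misbehaved G {q} M 1 := by
    simp [misbehaved, AcceptableInit, hinit q (by simp)]
  have := ((hD {q} _ M (isLocalSet_of_card_le (by simpa using hf)) hM i (by simpa using hiq)
    1).1 q hmis).2.1 hq
  exact notMem_detection_of_not_isTwoHopIn h1 h2 _ (Finset.mem_union_left _ this)

/-- If `i` cannot observe an out-neighbour `l` of its in-neighbour `j`, then it takes `j` for
malicious as soon as `j` rightly reports the silent node `l`. -/
theorem DetectsMisbehaviour.detectable_of_mem_outNbrs_inNbr (hG : ∀ v, ¬ G.Adj v v)
    (hD : DetectsMisbehaviour G f) (hf : 1 ≤ f) {i j l : V} (hj : j ∈ inNbrs G i)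
    (hl : l ∈ outNbrs G j) (hli : l ≠ i) : Detectable G f l i := by
  by_contra hnd
  have hji : G.Adj j i := by simpa using hj
  have hjl : G.Adj j l := by simpa using hl
  have h2 : ¬ IsTwoHopIn G l i := fun h => hnd (hD.detectable_of_isTwoHopIn hf h)
  have h1 : l ∉ inNbrs G i := fun h => hnd (Or.inl h)
  have hne : j ≠ l := fun h => hG l (h ▸ hjl)
  have hlj : l ∉ inNbrs G j := fun h => h2 ⟨j, mem_twoHopMiddle.2
    ⟨hli, hne, fun h' => hG i (h' ▸ hji), by simpa using h, hji⟩⟩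
  have hlj2 : IsTwoHopIn G l j := by
    rcases hD.detectable_of_mem_outNbrs hG hf hl with h | h
    · exact absurd h hlj
    · exact Finset.card_pos.1 (by omega)
  obtain ⟨M, hM, hinit, -⟩ := exists_isRun G f {l} (fun _ => 0) (fun _ => none) fun _ _ => none
  have hloc : IsLocalSet G f {l} := isLocalSet_of_card_le (by simpa using hf)
  have hmis : l ∈ misbehaved G {l} M 1 := by
    simp [misbehaved, AcceptableInit, hinit l (by simp)]
  have hjA : j ∉ ({l} : Finset V) := by simpa using hne
  have hdet : l ∈ (detection G f M j 2).det := ((hD {l} _ M hloc hM j hjA 1).1 l hmis).2.1 hl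
  have hfail : ¬ PassesChecks G f M i (detection G f M i 2).known (detection G f M i 3).known
      1 j := by
    rintro ⟨φ, hφ, -, -, hcheck, -⟩
    rw [hM.info j hjA 1, Option.some.injEq] at hφ
    subst hφ
    have := (hcheck l hlj2 hlj).1 hdet
    exact notMem_detection_of_not_isTwoHopIn h1 h2 _ (known_subset_det_union i 3 this)
  have hdetj : j ∈ (detection G f M i 3).det := mem_det_of_not_passesChecks hj hfail
  have := (hD {l} _ M hloc hM i (by simpa using hli.symm) 3).2 (Finset.mem_union_left _ hdetj)
  exact hjA (misbehaved_subset _ this)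

theorem DetectsMisbehaviour.graphCondition (hG : ∀ v, ¬ G.Adj v v) (hf : 1 ≤ f)
    (hD : DetectsMisbehaviour G f) : GraphCondition G f where
  twoHop _ _ h := hD.detectable_of_isTwoHopIn hf h
  out _ _ h := hD.detectable_of_mem_outNbrs hG hf h
  outOfIn _ _ _ hj hl hne := hD.detectable_of_mem_outNbrs_inNbr hG hf hj hl hne

end Necessity

/-! ### Ratio consensus for column-stochastic linear maps -/

section RatioConsensus

variable {ι : Type*} {s : Finset ι}

/-- `T` acts on the coordinates in `s` as a column-stochastic matrix: it preserves nonnegativity and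
the total mass. -/
structure IsColumnStochasticOn (s : Finset ι) (T : (ι → ℝ) →ₗ[ℝ] (ι → ℝ)) : Prop where
  nonneg : ∀ u, (∀ j ∈ s, 0 ≤ u j) → ∀ j ∈ s, 0 ≤ T u j
  sum_eq : ∀ u, ∑ j ∈ s, T u j = ∑ j ∈ s, u j

theorem IsColumnStochasticOn.pow {T : (ι → ℝ) →ₗ[ℝ] (ι → ℝ)} (hT : IsColumnStochasticOn s T)
    (n : ℕ) : IsColumnStochasticOn s (T ^ n) := by
  induction n with
  | zero => exact ⟨fun u hu => hu, fun u => rfl⟩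
  | succ n ih =>
    rw [pow_succ']
    exact ⟨fun u hu => hT.nonneg _ (ih.nonneg u hu), fun u => (hT.sum_eq _).trans (ih.sum_eq u)⟩

theorem apply_eq_posPart_sub_negPart (T : (ι → ℝ) →ₗ[ℝ] (ι → ℝ)) (u : ι → ℝ) (j : ι) :
    T u j = T u⁺ j - T u⁻ j := by
  conv_lhs => rw [← posPart_sub_negPart u, map_sub]
  rfl

theorem sum_posPart_add_sum_negPart (s : Finset ι) (u : ι → ℝ) :
    ∑ j ∈ s, u⁺ j + ∑ j ∈ s, u⁻ j = ∑ j ∈ s, |u j| := by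
  rw [← Finset.sum_add_distrib]
  exact Finset.sum_congr rfl fun j _ => by
    rw [Pi.posPart_apply, Pi.negPart_apply, posPart_add_negPart]

theorem IsColumnStochasticOn.sum_abs_le {T : (ι → ℝ) →ₗ[ℝ] (ι → ℝ)}
    (hT : IsColumnStochasticOn s T) (u : ι → ℝ) : ∑ j ∈ s, |T u j| ≤ ∑ j ∈ s, |u j| := by
  rw [← sum_posPart_add_sum_negPart s u, ← hT.sum_eq u⁺, ← hT.sum_eq u⁻, ← Finset.sum_add_distrib]
  refine Finset.sum_le_sum fun j hj => ?_
  have h1 := hT.nonneg u⁺ (fun j _ => posPart_nonneg u j) j hj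
  have h2 := hT.nonneg u⁻ (fun j _ => negPart_nonneg u j) j hj
  rw [apply_eq_posPart_sub_negPart, abs_le]
  constructor <;> linarith

/-- A column-stochastic map with a positive row `i` contracts the vectors of total mass zero:
the images of the positive and of the negative part overlap in the coordinate `i`. -/
theorem IsColumnStochasticOn.sum_abs_le_of_row {T : (ι → ℝ) →ₗ[ℝ] (ι → ℝ)}
    (hT : IsColumnStochasticOn s T) {i : ι} (hi : i ∈ s) {ε : ℝ}
    (hε : ∀ u : ι → ℝ, (∀ j ∈ s, 0 ≤ u j) → ε * ∑ j ∈ s, u j ≤ T u i)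
    {u : ι → ℝ} (hu : ∑ j ∈ s, u j = 0) :
    ∑ j ∈ s, |T u j| ≤ (1 - ε) * ∑ j ∈ s, |u j| := by
  have hp : ∀ j ∈ s, 0 ≤ u⁺ j := fun j _ => posPart_nonneg u j
  have hq : ∀ j ∈ s, 0 ≤ u⁻ j := fun j _ => negPart_nonneg u j
  have hpq : ∑ j ∈ s, u⁺ j = ∑ j ∈ s, u⁻ j := by
    rw [← sub_eq_zero, ← Finset.sum_sub_distrib, ← hu]
    exact Finset.sum_congr rfl fun j _ => by
      rw [Pi.posPart_apply, Pi.negPart_apply, posPart_sub_negPart]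
  have hsum := sum_posPart_add_sum_negPart s u
  have h1 := hε _ hp
  have h2 := hε _ hq
  have h3 : ∑ j ∈ s, (T u⁺ j + T u⁻ j) = ∑ j ∈ s, |u j| := by
    rw [Finset.sum_add_distrib, hT.sum_eq, hT.sum_eq, hsum]
  rw [← Finset.add_sum_erase s _ hi] at h3 ⊢
  have h4 : ∑ j ∈ s.erase i, |T u j| ≤ ∑ j ∈ s.erase i, (T u⁺ j + T u⁻ j) := by
    refine Finset.sum_le_sum fun j hj => ?_
    have h1 := hT.nonneg _ hp j (Finset.mem_of_mem_erase hj)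
    have h2 := hT.nonneg _ hq j (Finset.mem_of_mem_erase hj)
    rw [apply_eq_posPart_sub_negPart, abs_le]
    constructor <;> linarith
  have h5 : |T u i| ≤ T u⁺ i + T u⁻ i - ε * ∑ j ∈ s, |u j| := by
    rw [apply_eq_posPart_sub_negPart, abs_le, ← hsum, hpq]
    rw [hpq] at h1
    constructor <;> linarith
  linarith

theorem IsColumnStochasticOn.tendsto_pow_apply_zero {T : (ι → ℝ) →ₗ[ℝ] (ι → ℝ)}
    (hT : IsColumnStochasticOn s T) {i : ι} (hi : i ∈ s) {ε : ℝ} (hε0 : 0 < ε) {n : ℕ}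
    (hε : ∀ u : ι → ℝ, (∀ j ∈ s, 0 ≤ u j) → ε * ∑ j ∈ s, u j ≤ (T ^ n) u i)
    {u : ι → ℝ} (hu : ∑ j ∈ s, u j = 0) :
    Tendsto (fun k => (T ^ k) u i) atTop (𝓝 0) := by
  set N : ℕ → ℝ := fun k => ∑ j ∈ s, |(T ^ k) u j| with hN
  have hN0 : ∀ k, 0 ≤ N k := fun k => Finset.sum_nonneg fun j _ => abs_nonneg _
  have hanti : Antitone N := antitone_nat_of_succ_le fun k => by
    simp only [hN, pow_succ']
    exact hT.sum_abs_le _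
  have hlim := tendsto_atTop_ciInf hanti ⟨0, by rintro _ ⟨k, rfl⟩; exact hN0 k⟩
  set L := ⨅ k, N k
  have hL0 : 0 ≤ L := ge_of_tendsto' hlim hN0
  have hcontr : ∀ k, N (k + n) ≤ (1 - ε) * N k := fun k => by
    simp only [hN, add_comm k n, pow_add]
    exact (hT.pow n).sum_abs_le_of_row hi hε (((hT.pow k).sum_eq u).trans hu)
  have hL : L ≤ (1 - ε) * L :=
    le_of_tendsto_of_tendsto' (hlim.comp (tendsto_add_atTop_nat n)) (hlim.const_mul _) hcontr
  have hL' : L = 0 := by nlinarith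
  rw [hL'] at hlim
  exact squeeze_zero_norm
    (fun k => Finset.single_le_sum (f := fun j => |(T ^ k) u j|) (fun j _ => abs_nonneg _) hi) hlim

/-- Ratio consensus: if two vectors evolve by the same column-stochastic map, some power of which
has a positive row `i`, then the quotients of their `i`-th coordinates converge to the quotient of
the total masses.  The denominators may be negative in the beginning. -/
theorem IsColumnStochasticOn.tendsto_ratio {T : (ι → ℝ) →ₗ[ℝ] (ι → ℝ)}
    (hT : IsColumnStochasticOn s T) {i : ι} (hi : i ∈ s) {ε : ℝ} (hε0 : 0 < ε) {n : ℕ}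
    (hε : ∀ u : ι → ℝ, (∀ j ∈ s, 0 ≤ u j) → ε * ∑ j ∈ s, u j ≤ (T ^ n) u i)
    (y z : ι → ℝ) (hz : 0 < ∑ j ∈ s, z j) :
    Tendsto (fun k => (T ^ k) y i / (T ^ k) z i) atTop
      (𝓝 ((∑ j ∈ s, y j) / ∑ j ∈ s, z j)) := by
  set Y := ∑ j ∈ s, y j with hY
  set Z := ∑ j ∈ s, z j with hZ
  have h1 : Tendsto (fun k => (T ^ k) (y - (Y / Z) • z) i) atTop (𝓝 0) := by
    refine hT.tendsto_pow_apply_zero hi hε0 hε ?_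
    simp only [Pi.sub_apply, Pi.smul_apply, smul_eq_mul, Finset.sum_sub_distrib,
      ← Finset.mul_sum, ← hY, ← hZ]
    field_simp
    ring
  -- The denominators are compared with the trajectory of a nonnegative vector of the same mass.
  set v : ι → ℝ := Pi.single i Z with hv
  have hvs : ∑ j ∈ s, v j = Z := by simp [hv, hi]
  have hv0 : ∀ j ∈ s, 0 ≤ v j := fun j _ => by
    have : 0 ≤ v := Pi.single_nonneg.2 hz.le
    exact this j
  have h2 : Tendsto (fun k => (T ^ k) (z - v) i) atTop (𝓝 0) := by
    refine hT.tendsto_pow_apply_zero hi hε0 hε ?_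
    simp only [Pi.sub_apply, Finset.sum_sub_distrib, hvs, ← hZ, sub_self]
  have hvk : ∀ k, n ≤ k → ε * Z ≤ (T ^ k) v i := fun k hk => by
    obtain ⟨m, rfl⟩ := Nat.exists_eq_add_of_le hk
    have := hε ((T ^ m) v) ((hT.pow m).nonneg v hv0)
    rwa [(hT.pow m).sum_eq, hvs, ← Module.End.mul_apply, ← pow_add] at this
  have hεZ : 0 < ε * Z / 2 := by positivity
  have hzk : ∀ᶠ k in atTop, ε * Z / 2 ≤ (T ^ k) z i := by
    filter_upwards [h2.eventually (lt_mem_nhds (neg_lt_zero.2 hεZ)), eventually_ge_atTop n]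
      with k hk hn
    have := hvk k hn
    simp only [map_sub, Pi.sub_apply] at hk
    linarith
  rw [tendsto_iff_norm_sub_tendsto_zero]
  have h3 : Tendsto (fun k => ‖(T ^ k) (y - (Y / Z) • z) i‖ / (ε * Z / 2)) atTop (𝓝 0) := by
    simpa using h1.norm.div_const (ε * Z / 2)
  refine squeeze_zero' (Eventually.of_forall fun k => norm_nonneg _) ?_ h3
  filter_upwards [hzk] with k hk
  have hpos : 0 < (T ^ k) z i := hεZ.trans_le hk
  have : (T ^ k) y i / (T ^ k) z i - Y / Z = (T ^ k) (y - (Y / Z) • z) i / (T ^ k) z i := by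
    simp only [map_sub, map_smul, Pi.sub_apply, Pi.smul_apply, smul_eq_mul]
    field_simp
  rw [this, norm_div]
  gcongr
  rwa [Real.norm_of_nonneg hpos.le]

end RatioConsensus

/-! ### The averaging dynamics after the last exposure -/

section Dynamics

variable {G : Digraph V}

/-- One step of the averaging dynamics on the nodes outside `B`: every such node splits its value
evenly among itself and its out-neighbours outside `B`. -/
noncomputable def avgStep (G : Digraph V) (B : Finset V) : (V → ℝ) →ₗ[ℝ] (V → ℝ) where
  toFun u j := if j ∈ B then 0 else
    ∑ h ∈ insert j (inNbrs G j) \ B, (1 + ((outNbrs G h \ B).card : ℝ))⁻¹ * u h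
  map_add' u v := by
    funext j
    by_cases hj : j ∈ B <;> simp [hj, mul_add, Finset.sum_add_distrib]
  map_smul' c u := by
    funext j
    by_cases hj : j ∈ B <;> simp [hj, Finset.mul_sum, mul_left_comm]

theorem avgStep_apply {B : Finset V} {j : V} (hj : j ∉ B) (u : V → ℝ) :
    avgStep G B u j =
      ∑ h ∈ insert j (inNbrs G j) \ B, (1 + ((outNbrs G h \ B).card : ℝ))⁻¹ * u h :=
  if_neg hj

/-- Double counting of the edges, with a loop at each node, that avoid `B`. -/
theorem sum_sum_inNbrs_sdiff (hG : ∀ v, ¬ G.Adj v v) {E : Type*} [AddCommGroup E] [Module ℝ E]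
    (B : Finset V) (g : V → E) :
    ∑ j ∈ Bᶜ, ∑ h ∈ insert j (inNbrs G j) \ B, g h =
      ∑ h ∈ Bᶜ, (1 + ((outNbrs G h \ B).card : ℝ)) • g h := by
  rw [Finset.sum_comm' (t' := Bᶜ) (s' := fun h => insert h (outNbrs G h) \ B)]
  · refine Finset.sum_congr rfl fun h hh => ?_
    rw [Finset.mem_compl] at hh
    rw [Finset.sum_const, Finset.insert_sdiff_of_notMem _ hh,
      Finset.card_insert_of_notMem (by simp [hG]), ← Nat.cast_smul_eq_nsmul ℝ]
    push_cast
    rw [add_comm]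
  · intro j h
    simp only [Finset.mem_compl, Finset.mem_sdiff, Finset.mem_insert, mem_inNbrs, mem_outNbrs,
      eq_comm (a := h)]
    tauto

theorem isColumnStochasticOn_avgStep (hG : ∀ v, ¬ G.Adj v v) (B : Finset V) :
    IsColumnStochasticOn Bᶜ (avgStep G B) where
  nonneg u hu j hj := by
    rw [avgStep_apply (Finset.mem_compl.1 hj)]
    refine Finset.sum_nonneg fun h hh => mul_nonneg (by positivity) (hu h ?_)
    exact Finset.mem_compl.2 (Finset.mem_sdiff.1 hh).2
  sum_eq u := by
    rw [Finset.sum_congr rfl fun j hj => avgStep_apply (Finset.mem_compl.1 hj) u,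
      sum_sum_inNbrs_sdiff hG]
    refine Finset.sum_congr rfl fun h _ => ?_
    rw [smul_eq_mul, mul_inv_cancel_left₀ (by positivity)]

theorem le_avgStep {B : Finset V} {u : V → ℝ} (hu : ∀ j ∈ Bᶜ, 0 ≤ u j) {h j : V} (hh : h ∉ B)
    (hj : j ∉ B) (hhj : h = j ∨ G.Adj h j) :
    (1 + (Fintype.card V : ℝ))⁻¹ * u h ≤ avgStep G B u j := by
  rw [avgStep_apply hj]
  have hmem : h ∈ insert j (inNbrs G j) \ B := by simp [hh, hhj]
  refine le_trans ?_ (Finset.single_le_sum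
    (f := fun h => (1 + ((outNbrs G h \ B).card : ℝ))⁻¹ * u h) (fun l hl => ?_) hmem)
  · have := hu h (Finset.mem_compl.2 hh)
    have := Finset.card_le_univ (outNbrs G h \ B)
    gcongr
  · exact mul_nonneg (by positivity) (hu l (Finset.mem_compl.2 (Finset.mem_sdiff.1 hl).2))

/-- Row `i` of the `n`-th power of the averaging matrix has an entry at least `ε` in column `h`. -/
def EntryGe (G : Digraph V) (B : Finset V) (i h : V) (n : ℕ) (ε : ℝ) : Prop :=
  ∀ u : V → ℝ, (∀ j ∈ Bᶜ, 0 ≤ u j) → ε * u h ≤ (avgStep G B ^ n) u i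

theorem EntryGe.succ (hG : ∀ v, ¬ G.Adj v v) {B : Finset V} {i j h : V} {n : ℕ} {ε : ℝ}
    (H : EntryGe G B i h n ε) (hi : i ∉ B) (hj : j ∉ B) (hij : i = j ∨ G.Adj i j) :
    EntryGe G B j h (n + 1) ((1 + (Fintype.card V : ℝ))⁻¹ * ε) := by
  intro u hu
  rw [pow_succ', Module.End.mul_apply]
  refine le_trans ?_
    (le_avgStep (((isColumnStochasticOn_avgStep hG B).pow n).nonneg u hu) hi hj hij)
  rw [mul_assoc]
  gcongr
  exact H u hu

theorem EntryGe.add (hG : ∀ v, ¬ G.Adj v v) {B : Finset V} {i h : V} {n : ℕ} {ε : ℝ}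
    (H : EntryGe G B i h n ε) (hi : i ∉ B) (m : ℕ) :
    EntryGe G B i h (n + m) ((1 + (Fintype.card V : ℝ))⁻¹ ^ m * ε) := by
  induction m with
  | zero => simpa using H
  | succ m ih =>
    rw [pow_succ', mul_assoc]
    exact ih.succ hG hi hi (Or.inl rfl)

theorem EntryGe.mono {B : Finset V} {i h : V} {n : ℕ} {ε ε' : ℝ}
    (H : EntryGe G B i h n ε) (hh : h ∉ B) (hε : ε' ≤ ε) : EntryGe G B i h n ε' := fun u hu =>
  (mul_le_mul_of_nonneg_right hε (hu h (Finset.mem_compl.2 hh))).trans (H u hu)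

theorem exists_entryGe (hG : ∀ v, ¬ G.Adj v v) {B : Finset V} {h i : V}
    (hp : Relation.ReflTransGen (fun a b => G.Adj a b ∧ a ∉ B ∧ b ∉ B) h i) :
    ∃ n, ∃ ε > 0, EntryGe G B i h n ε := by
  induction hp with
  | refl => exact ⟨0, 1, one_pos, fun u _ => by simp⟩
  | tail _ hbc ih =>
    obtain ⟨n, ε, hε, H⟩ := ih
    exact ⟨n + 1, _, by positivity, H.succ hG hbc.2.1 hbc.2.2 (Or.inr hbc.1)⟩

/-- If every node outside `B` reaches `i`, then some power of the averaging matrix has a positive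
row `i`.  As every node keeps a share of its own value, entries remain positive. -/
theorem exists_row_pos (hG : ∀ v, ¬ G.Adj v v) {B : Finset V} {i : V} (hi : i ∉ B)
    (hp : ∀ h, h ∉ B → Relation.ReflTransGen (fun a b => G.Adj a b ∧ a ∉ B ∧ b ∉ B) h i) :
    ∃ n, ∃ ε > 0, ∀ u : V → ℝ, (∀ j ∈ Bᶜ, 0 ≤ u j) →
      ε * ∑ j ∈ Bᶜ, u j ≤ (avgStep G B ^ n) u i := by
  have key : ∀ t ⊆ Bᶜ, ∃ n, ∃ ε > 0, ∀ h ∈ t, EntryGe G B i h n ε := by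
    intro t
    induction t using Finset.induction_on with
    | empty => exact fun _ => ⟨0, 1, one_pos, by simp⟩
    | insert a t _ ih =>
      intro ht
      rw [Finset.insert_subset_iff] at ht
      have ha := Finset.mem_compl.1 ht.1
      obtain ⟨n₁, ε₁, hε₁, H₁⟩ := ih ht.2
      obtain ⟨n₂, ε₂, hε₂, H₂⟩ := exists_entryGe hG (hp a ha)
      refine ⟨n₁ + n₂, _, lt_min (a := 0) (b := (1 + (Fintype.card V : ℝ))⁻¹ ^ n₂ * ε₁)
        (c := (1 + (Fintype.card V : ℝ))⁻¹ ^ n₁ * ε₂) (by positivity) (by positivity), ?_⟩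
      intro h hh
      rcases Finset.mem_insert.1 hh with rfl | hh
      · rw [add_comm]
        exact (H₂.add hG hi n₁).mono ha (min_le_right _ _)
      · exact ((H₁ h hh).add hG hi n₂).mono (Finset.mem_compl.1 (ht.2 hh)) (min_le_left _ _)
  obtain ⟨n, ε, hε, H⟩ := key Bᶜ subset_rfl
  have hcard : (0 : ℝ) < (Bᶜ : Finset V).card := by
    exact_mod_cast Finset.card_pos.2 ⟨i, Finset.mem_compl.2 hi⟩
  refine ⟨n, ε / (Bᶜ : Finset V).card, by positivity, fun u hu => ?_⟩
  rw [div_mul_eq_mul_div, div_le_iff₀ hcard, Finset.mul_sum, mul_comm, ← nsmul_eq_mul]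
  exact Finset.sum_le_card_nsmul _ _ _ fun h hh => H h hh u hu

end Dynamics

/-! ### Running sums of the nodes that never misbehave -/

section RunningSums

variable {G : Digraph V} {f : ℕ} {A : Finset V} {x : V → ℝ} {M : Transcript V}

/-- Every adversary node has a normal out-neighbour.  Strong connectivity alone does not connect the
proper adversary nodes to the normal ones: they disappear together with `A`, and the set of
misbehaving nodes need not be `f`-local, as its in-neighbour bound may fail at nodes of `A`.  But by
the detection condition the nodes of `A` without normal out-neighbours form a set closed under taking
out-neighbours, and strong connectivity of `G` itself rules this out unless it is empty. -/
theorem GraphCondition.exists_adj_notMem (hG : ∀ v, ¬ G.Adj v v) (hgc : GraphCondition G f)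
    (hA : IsLocalSet G f A) (hconn : StronglyConnectedWithout G ∅) {i u : V} (hi : i ∉ A)
    (hu : u ∈ A) : ∃ v, G.Adj u v ∧ v ∉ A := by
  by_contra! hcon
  have key : ∀ w, Relation.ReflTransGen (fun a b => G.Adj a b ∧ a ∉ (∅ : Finset V) ∧
      b ∉ (∅ : Finset V)) u w → w ∈ A ∧ ∀ v, G.Adj w v → v ∈ A := by
    intro w hw
    induction hw with
    | refl => exact ⟨hu, hcon⟩
    | @tail b c _ hbc ih =>
      refine ⟨ih.2 c hbc.1, fun v hv => ?_⟩
      by_contra hvA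
      have hbv : b ≠ v := fun h => hvA (h ▸ ih.1)
      have hmid : c ∈ twoHopMiddle G b v := mem_twoHopMiddle.2
        ⟨hbv, fun h => hG b (h ▸ hbc.1), fun h => hG v (h ▸ hv), hbc.1, hv⟩
      rcases hgc.twoHop v b ⟨c, hmid⟩ with h | h
      · exact hvA (ih.2 v (by simpa using h))
      · obtain ⟨p, hp, hpA⟩ := hA.exists_notMem hvA (twoHopMiddle_subset_inNbrs b v)
          (by omega : f + 1 ≤ _)
        exact hpA (ih.2 p (mem_twoHopMiddle.1 hp).2.2.2.1)
  exact hi (key i (hconn u i (by simp) (by simp))).1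

theorem GraphCondition.reaches (hG : ∀ v, ¬ G.Adj v v) (hgc : GraphCondition G f)
    (hA : IsLocalSet G f A) (hconn : IsRStronglyConnected G (f + 1)) {B : Finset V} (hB : B ⊆ A)
    {i u : V} (hi : i ∉ A) (hu : u ∉ B) :
    Relation.ReflTransGen (fun a b => G.Adj a b ∧ a ∉ B ∧ b ∉ B) u i := by
  have hnormal : ∀ v, v ∉ A →
      Relation.ReflTransGen (fun a b => G.Adj a b ∧ a ∉ B ∧ b ∉ B) v i := fun v hv =>
    (hconn A hA v i hv hi).lift id fun a b h =>
      ⟨h.1, fun h' => h.2.1 (hB h'), fun h' => h.2.2 (hB h')⟩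
  by_cases huA : u ∈ A
  · have h0 : StronglyConnectedWithout G ∅ := hconn ∅ fun i _ => by simp
    obtain ⟨v, huv, hv⟩ := hgc.exists_adj_notMem hG hA h0 hi huA
    exact (hnormal v hv).head ⟨huv, hu, fun h => hv (hB h)⟩
  · exact hnormal u huA

/-- The pair that `j` has sent as its running sums of time `k`, with `0` for a missing message. -/
noncomputable def ownSum (M : Transcript V) (k : ℕ) (j : V) : ℝ × ℝ := (M.ownAt k j).getD 0

/-- The pair that `j` has relayed for `h` at time `k`, with `0` for a missing one. -/
noncomputable def relayed (M : Transcript V) (k : ℕ) (j h : V) : ℝ × ℝ := (M.relayAt k j h).getD 0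

theorem conforms_of_mem_properNodes (hG : ∀ v, ¬ G.Adj v v) (hgc : GraphCondition G f)
    (hA : IsLocalSet G f A) (hM : IsRun G f A x M) {j : V} (hj : j ∈ properNodes G A M) (k : ℕ) :
    Conforms G M (misbehaved G A M k) (misbehaved G A M (k + 1)) k j := by
  by_cases hjA : j ∈ A
  · by_contra hc
    have := (Finset.mem_filter.1 hj).2 (k + 2)
    exact this (Finset.mem_union_right _ (Finset.mem_filter.2 ⟨hjA, hc⟩))
  · exact hM.conforms_of_notMem hgc hA (correctAt hG hgc hA hM k)
      (correctAt hG hgc hA hM (k + 1)) hjA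

theorem ownSum_one_eq (hM : IsRun G f A x M) {j : V} (hj : j ∈ properNodes G A M) :
    ownSum M 1 j = initialPair G (initialValue G A x M j) j := by
  by_cases hjA : j ∈ A
  · have h1 := (Finset.mem_filter.1 hj).2 1
    simp only [misbehaved, Finset.mem_filter, hjA, true_and, not_not] at h1
    obtain ⟨y, hy⟩ := h1
    have : initialValue G A x M j = y := by
      simp only [initialValue, hjA, if_true, hy, Option.getD_some, initialPair, Prod.smul_mk,
        smul_eq_mul]
      rw [mul_inv_cancel_left₀ (by positivity)]
    rw [this]
    simp [ownSum, Transcript.ownAt, hy]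
  · simp [ownSum, Transcript.ownAt, hM.init j hjA, initialValue, hjA]

/-- The fields of a conforming information set, in terms of what has been broadcast. -/
theorem Conforms.spec {B B' : Finset V} {k : ℕ} {j : V} (h : Conforms G M B B' k j) :
    (∀ l ∈ outNbrs G j, (l ∈ M.reportedAt (k + 1) j → l ∈ B') ∧
      (l ∈ B → B ⊆ B' → l ∈ M.reportedAt (k + 1) j)) ∧
    (∀ h ∈ insert j (inNbrs G j), relayed M (k + 1) j h = if h ∈ B' then 0 else
      ownSum M (k + 1) h) ∧
    ownSum M (k + 2) j = nextSums G j (M.reportedAt k j) (M.reportedAt (k + 1) j)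
      (relayed M k j) (relayed M (k + 1) j) := by
  obtain ⟨φ, hφ, -, hin, hout, hrel, hown⟩ := h
  have hrep : M.reportedAt (k + 1) j = φ.detected := by simp [Transcript.reportedAt, hφ]
  have hrly : ∀ h, relayed M (k + 1) j h = (φ.relay h).getD 0 := fun h => by
    simp [relayed, Transcript.relayAt, hφ]
  refine ⟨fun l hl => ?_, fun h hh => ?_, ?_⟩
  · rw [hrep]
    by_cases hlin : l ∈ inNbrs G j
    · exact ⟨(hin l hlin).1, fun h h' => (hin l hlin).2 (h' h)⟩
    · exact ⟨(hout l hl hlin).1, fun h _ => (hout l hl hlin).2 h⟩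
  · rw [hrly, hrel h hh]
    split_ifs <;> rfl
  · rw [hrep, funext hrly]
    simp only [ownSum, Transcript.ownAt, hφ, Option.map_some, Option.getD_some, hown]
    rfl

/-- Mass balance of a proper node: what it has passed on in total, to itself and to the
out-neighbours that it has not excluded, is its initial value plus what it has received.  The
compensation term of the update keeps this valid when out-neighbours are excluded. -/
theorem smul_ownSum_succ (hG : ∀ v, ¬ G.Adj v v) (hgc : GraphCondition G f)
    (hA : IsLocalSet G f A) (hM : IsRun G f A x M) {j : V} (hj : j ∈ properNodes G A M) (k : ℕ) :
    (1 + ((outNbrs G j \ M.reportedAt k j).card : ℝ)) • ownSum M (k + 1) j =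
      (initialValue G A x M j, 1) + ∑ h ∈ insert j (inNbrs G j), relayed M k j h := by
  induction k with
  | zero =>
    rw [ownSum_one_eq hM hj]
    simp only [Transcript.reportedAt, Finset.sdiff_empty, initialPair]
    rw [smul_inv_smul₀ (one_add_card_ne_zero _)]
    simp [relayed, Transcript.relayAt]
  | succ k ih =>
    obtain ⟨hdet, hrel, hown⟩ := (conforms_of_mem_properNodes hG hgc hA hM hj k).spec
    have hjB : j ∉ misbehaved G A M (k + 1) := (Finset.mem_filter.1 hj).2 _
    have hself : relayed M (k + 1) j j = ownSum M (k + 1) j := by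
      rw [hrel j (Finset.mem_insert_self _ _), if_neg hjB]
    -- An exclusion is never withdrawn: what `j` reports at time `k` has misbehaved by time `k`, and `j`
    -- has to report it at time `k + 1`.
    have hsub : outNbrs G j \ M.reportedAt (k + 1) j ⊆ outNbrs G j \ M.reportedAt k j := by
      intro l hl
      rw [Finset.mem_sdiff] at hl ⊢
      refine ⟨hl.1, fun h => hl.2 ((hdet l hl.1).2 ?_ (misbehaved_subset_succ k))⟩
      cases k with
      | zero => simp [Transcript.reportedAt] at h
      | succ k =>
        exact ((conforms_of_mem_properNodes hG hgc hA hM hj k).spec.1 l hl.1).1 h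
    have hcard : (((outNbrs G j \ M.reportedAt k j) \ (outNbrs G j \ M.reportedAt (k + 1) j)).card
        : ℝ) = (outNbrs G j \ M.reportedAt k j).card -
          (outNbrs G j \ M.reportedAt (k + 1) j).card := by
      rw [Finset.card_sdiff_of_subset hsub, Nat.cast_sub (Finset.card_le_card hsub)]
    rw [hown, nextSums, averaging, smul_add, smul_inv_smul₀ (one_add_card_ne_zero _), hcard, hself,
      Finset.sum_sub_distrib]
    rw [eq_sub_of_add_eq' ih.symm]
    module

end RunningSums

/-! ### Convergence -/

section Convergence

variable {G : Digraph V} {f : ℕ} {A : Finset V} {x : V → ℝ} {M : Transcript V}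

/-- From some time on, no further node is exposed. -/
theorem exists_misbehaved_eq (G : Digraph V) (A : Finset V) (M : Transcript V) :
    ∃ K, ∀ k, K ≤ k → misbehaved G A M k = (properNodes G A M)ᶜ := by
  obtain ⟨K, hK⟩ := WellFoundedGT.monotone_chain_condition
    ⟨misbehaved G A M, misbehaved_mono⟩
  refine ⟨K, fun k hk => ?_⟩
  ext j
  simp only [properNodes, Finset.mem_compl, Finset.mem_filter, Finset.mem_univ, true_and,
    not_forall, not_not]
  refine ⟨fun h => ⟨k, h⟩, fun ⟨n, hn⟩ => ?_⟩
  have h1 : misbehaved G A M K = misbehaved G A M k := hK k hk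
  have h2 : misbehaved G A M K = misbehaved G A M (max K n) := hK _ (le_max_left _ _)
  rw [← h1, h2]
  exact misbehaved_mono (le_max_right K n) hn

theorem yz_succ_eq (hM : IsRun G f A x M) {i : V} (hi : i ∉ A) (k : ℕ) :
    yz G f M (x i) i (k + 1) =
      (1 + ((outNbrs G i \ M.reportedAt (k + 1) i).card : ℝ)) •
        (ownSum M (k + 2) i - ownSum M (k + 1) i) := by
  have h : ownSum M (k + 2) i = ownSum M (k + 1) i +
      (1 + ((outNbrs G i \ M.reportedAt (k + 1) i).card : ℝ))⁻¹ • yz G f M (x i) i (k + 1) := by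
    rw [hM.reportedAt_eq hi]
    simp [ownSum, Transcript.ownAt, hM.info i hi k, normalInfo, nextSums, yz, table]
  rw [h, add_sub_cancel_left, smul_inv_smul₀ (one_add_card_ne_zero _)]

theorem achievesRAC (hG : ∀ v, ¬ G.Adj v v) (hgc : GraphCondition G f)
    (hconn : IsRStronglyConnected G (f + 1)) : AchievesRAC G f := by
  intro A x M hA hM i hi
  obtain ⟨K, hK⟩ := exists_misbehaved_eq G A M
  set B := (properNodes G A M)ᶜ with hBdef
  have hN : properNodes G A M = Bᶜ := (compl_compl _).symm
  have hBA : B ⊆ A := hK K le_rfl ▸ misbehaved_subset K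
  have hiB : i ∉ B := fun h => hi (hBA h)
  have hproper : ∀ j, j ∉ B → j ∈ properNodes G A M := fun j hj => by
    rw [hN]; exact Finset.mem_compl.2 hj
  have hout : ∀ j, j ∉ B → ∀ k, K + 1 ≤ k → outNbrs G j \ M.reportedAt k j = outNbrs G j \ B := by
    intro j hj k hk
    obtain ⟨k, rfl⟩ : ∃ n, k = n + 1 := ⟨k - 1, by omega⟩
    have hs := (conforms_of_mem_properNodes hG hgc hA hM (hproper j hj) k).spec.1
    rw [hK k (by omega), hK (k + 1) (by omega)] at hs
    ext l
    simp only [Finset.mem_sdiff, and_congr_right_iff, not_iff_not]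
    exact fun hl => ⟨(hs l hl).1, fun h => (hs l hl).2 h subset_rfl⟩
  have hsum : ∀ j, j ∉ B → ∀ k, K + 1 ≤ k → ∑ h ∈ insert j (inNbrs G j), relayed M k j h =
      ∑ h ∈ insert j (inNbrs G j) \ B, ownSum M k h := by
    intro j hj k hk
    obtain ⟨k, rfl⟩ : ∃ n, k = n + 1 := ⟨k - 1, by omega⟩
    have hs := (conforms_of_mem_properNodes hG hgc hA hM (hproper j hj) k).spec.2.1
    rw [hK (k + 1) (by omega)] at hs
    rw [Finset.sum_congr rfl hs, Finset.sdiff_eq_filter, Finset.sum_filter]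
    simp only [ite_not]
  have hbal : ∀ j, j ∉ B → ∀ k, K + 1 ≤ k →
      (1 + ((outNbrs G j \ B).card : ℝ)) • ownSum M (k + 1) j =
        (initialValue G A x M j, 1) + ∑ h ∈ insert j (inNbrs G j) \ B, ownSum M k h := by
    intro j hj k hk
    rw [← hsum j hj k hk, ← smul_ownSum_succ hG hgc hA hM (hproper j hj) k, hout j hj k hk]
  -- The pairs `(y_j[k], z_j[k])` of the proper nodes.
  -- Once exclusions have ended, they satisfy a linear recursion.
  set w : ℕ → V → ℝ × ℝ := fun k j => if j ∈ B then 0 else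
    (1 + ((outNbrs G j \ B).card : ℝ)) • (ownSum M (k + 1) j - ownSum M k j) with hw
  have hwstep : ∀ k, K + 1 ≤ k → ∀ j, j ∉ B → w (k + 1) j =
      ∑ h ∈ insert j (inNbrs G j) \ B, (1 + ((outNbrs G h \ B).card : ℝ))⁻¹ • w k h := by
    intro k hk j hj
    simp only [hw, if_neg hj]
    rw [smul_sub, hbal j hj (k + 1) (by omega), hbal j hj k hk, add_sub_add_left_eq_sub,
      ← Finset.sum_sub_distrib]
    refine Finset.sum_congr rfl fun h hh => ?_
    rw [if_neg (Finset.mem_sdiff.1 hh).2, inv_smul_smul₀ (one_add_card_ne_zero _)]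
  have hwsum : ∑ j ∈ Bᶜ, w (K + 1) j = ∑ j ∈ Bᶜ, (initialValue G A x M j, (1 : ℝ)) := by
    have h1 : ∀ j ∈ Bᶜ, w (K + 1) j = (initialValue G A x M j, (1 : ℝ)) +
        (∑ h ∈ insert j (inNbrs G j) \ B, ownSum M (K + 1) h) -
          (1 + ((outNbrs G j \ B).card : ℝ)) • ownSum M (K + 1) j := fun j hj => by
      have hj := Finset.mem_compl.1 hj
      simp only [hw, if_neg hj]
      rw [smul_sub, hbal j hj _ le_rfl]
    rw [Finset.sum_congr rfl h1, Finset.sum_sub_distrib, Finset.sum_add_distrib,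
      sum_sum_inNbrs_sdiff hG, add_sub_cancel_right]
  have hpow : ∀ m, (fun j => (w (K + 1 + m) j).1) =
        (avgStep G B ^ m) (fun j => (w (K + 1) j).1) ∧
      (fun j => (w (K + 1 + m) j).2) = (avgStep G B ^ m) fun j => (w (K + 1) j).2 := by
    intro m
    induction m with
    | zero => exact ⟨rfl, rfl⟩
    | succ m ih =>
      rw [pow_succ', Module.End.mul_apply, Module.End.mul_apply, ← ih.1, ← ih.2]
      constructor <;> funext j <;> by_cases hj : j ∈ B
      · simp [hw, avgStep, hj]
      · rw [avgStep_apply hj, ← add_assoc, hwstep _ (by omega) j hj, Prod.fst_sum]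
        rfl
      · simp [hw, avgStep, hj]
      · rw [avgStep_apply hj, ← add_assoc, hwstep _ (by omega) j hj, Prod.snd_sum]
        rfl
  have hy : ∑ j ∈ Bᶜ, (w (K + 1) j).1 = ∑ j ∈ Bᶜ, initialValue G A x M j := by
    rw [← Prod.fst_sum, hwsum, Prod.fst_sum]
  have hz : ∑ j ∈ Bᶜ, (w (K + 1) j).2 = ((Bᶜ : Finset V).card : ℝ) := by
    rw [← Prod.snd_sum, hwsum, Prod.snd_sum]
    simp
  have hiB' : i ∈ Bᶜ := Finset.mem_compl.2 hiB
  -- Row `i` becomes positive because `i` is normal; proper adversary nodes may be transient.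
  obtain ⟨n, ε, hε0, hε⟩ := exists_row_pos hG hiB fun h hh => hgc.reaches hG hA hconn hBA hi hh
  have hlim := (isColumnStochasticOn_avgStep hG B).tendsto_ratio hiB' hε0 hε
    (fun j => (w (K + 1) j).1) (fun j => (w (K + 1) j).2) (by
      rw [hz]
      exact_mod_cast Finset.card_pos.2 ⟨i, hiB'⟩)
  rw [hy, hz, ← hN] at hlim
  refine (tendsto_add_atTop_iff_nat (K + 1)).1 (hlim.congr fun m => ?_)
  rw [← (hpow m).1, ← (hpow m).2]
  have : yz G f M (x i) i (m + (K + 1)) = w (K + 1 + m) i := by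
    rw [show m + (K + 1) = (K + m) + 1 by omega, yz_succ_eq hM hi, hout i hiB _ (by omega),
      show K + 1 + m = K + m + 1 by omega]
    simp only [hw, if_neg hiB]
  rw [ratio, this]

end Convergence

end ResilientAverage

theorem theorem1 {V : Type*} [Fintype V] [DecidableEq V] (G : Digraph V)
    (hG : ∀ v, ¬ G.Adj v v) (f : ℕ) (hf : 1 ≤ f) :
    (ResilientAverage.DetectsMisbehaviour G f ↔ ResilientAverage.GraphCondition G f) ∧
    (ResilientAverage.GraphCondition G f →
      ResilientAverage.IsRStronglyConnected G (f + 1) → ResilientAverage.AchievesRAC G f) :=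
  ⟨⟨fun h => h.graphCondition hG hf,
    fun h => ResilientAverage.detectsMisbehaviour_of_graphCondition hG h⟩,
    fun h hconn => ResilientAverage.achievesRAC hG h hconn⟩
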